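/- Let $k$ be an algebraically closed field of characteristic $0$ and let $\mathcal C$ be a $k$-linear premodular category, i.e. a ribbon fusion category over $k$ (abelian, $k$-linear with finite-dimensional $\mathrm{Hom}$-spaces, semisimple with finitely many simple objects, rigid, simple unit), with braiding $c_{A,B}:A\otimes B\to B\otimes A$, twist $\theta$, and (co)evaluations $\mathrm{coev}_X:\mathbf 1\to X\otimes X^*$, $\mathrm{ev}_X:X^*\otimes X\to\mathbf 1$, $\widetilde{\mathrm{ev}}_X=\mathrm{ev}_X\circ c_{X,X^*}\circ(\theta_X\otimes 1):X\otimes X^*\to\mathbf 1$. Associativity constraints are suppressed. A half-braiding on $X\in\mathcal C$ is a natural isomorphism $\lambda_A:A\otimes X\to X\otimes A$ with $\lambda_{A\otimes B}=(\lambda_A\otimes 1_B)(1_A\otimes\lambda_B)$. The elliptic Drinfeld center $\mathcal Z^{\mathrm{el}}(\mathcal C)$ has as objects the triples $(X,\lambda^1,\lambda^2)$ where $\lambda^1,\lambda^2$ are half-braidings on $X$ such that, for all $A,B$, $$(1_X\otimes c_{A,B})(\lambda^1_A\otimes 1_B)(1_A\otimes\lambda^2_B)=(\lambda^2_B\otimes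 1_A)(1_B\otimes\lambda^1_A)(c_{B,A}^{-1}\otimes 1_X);$$ its morphisms are the morphisms of $\mathcal C$ that intertwine both half-braidings. For half-braidings on $X$ put $$\lambda^\dagger_A=c_{A,X}\circ\lambda_A^{-1}\circ c_{X,A}^{-1},\qquad (\lambda^2\ltimes\lambda^1)_A=\lambda^2_A\circ(\lambda^1_A)^{-1}\circ c_{A,X}\circ(\theta_A\otimes 1_X).$$ Let $U_s,U_t$ be the autoequivalences (in fact automorphisms) of $\mathcal Z^{\mathrm{el}}(\mathcal C)$ which are the identity on underlying morphisms and are given on objects by $$U_s:(X,\lambda^1,\lambda^2)\mapsto(X,(\lambda^2)^\dagger,\lambda^1),\qquad U_t:(X,\lambda^1,\lambda^2)\mapsto(X,\lambda^1,\lambda^2\ltimes\lambda^1).$$ Let $s=\begin{pmatrix}0&-1\\1&0\end{pmatrix}$, $t=\begin{pmatrix}1&1\\0&1\end{pmatrix}$, $r_1: s^4=1$ and $r_2: sts=t^{-1}st^{-1}$. **Theorem.** The formulas $$(\gamma_1)_{(X,\lambda^1,\lambda^2)}=\theta_X,\qquad(\gamma_2)_{(X,\lambda^1,\lambda^2)}=(1_X\otimes\widetilde{\mathrm{ev}}_X)(\mu^2_X\otimes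 1_{X^*})(1_X\otimes\mathrm{coev}_X),\quad \mu^2=(\lambda^2)^\dagger,$$ define natural isomorphisms $\gamma_1:U_s^4\to\mathrm{id}$ and $\gamma_2:U_sU_tU_s\to U_t^{-1}U_sU_t^{-1}$ of endofunctors of $\mathcal Z^{\mathrm{el}}(\mathcal C)$, and $U_s,U_t,\gamma_1,\gamma_2$ generate an action of $\mathrm{SL}_2(\mathbb Z)=\langle s,t\mid r_1,r_2\rangle$ on $\mathcal Z^{\mathrm{el}}(\mathcal C)$ in the following sense. The group $\mathrm{SL}_2(\mathbb Z)$ is presented by the generators $s,t$ and the relations $r_1,r_2$. To an unreduced word $w=a_1\cdots a_n$ in $s^{\pm1},t^{\pm1}$ assign $U_w=U_{a_1}\cdots U_{a_n}$. To an elementary move $xvy\to xv'y$, where $x,y$ are words and $v=v'$ is $r_1$, $r_2$ or a trivial relation $aa^{-1}=1$, assign the natural isomorphism $U_x\gamma U_y:U_{xvy}\to U_{xv'y}$, where $\gamma$ is $\gamma_1$, $\gamma_2$ or the canonical isomorphism $U_aU_{a^{-1}}\cong\mathrm{id}$ respectively; to a reversed move assign the inverse. Then for any two words $w,w'$, all finite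 sequences of moves and reversed moves from $w$ to $w'$ give, by composition, the same natural isomorphism $U_w\to U_{w'}$. -/

import Mathlib

open CategoryTheory MonoidalCategory

universe v u

/-- A twist on a rigid braided monoidal category. -/
class RibbonCategory (C : Type u) [Category.{v} C] [MonoidalCategory C] [BraidedCategory C]
    [RightRigidCategory C] where
  twist : ∀ X : C, X ≅ X
  twist_naturality : ∀ {X Y : C} (f : X ⟶ Y), f ≫ (twist Y).hom = (twist X).hom ≫ f
  twist_tensor : ∀ X Y : C, (twist (X ⊗ Y)).hom =
    ((twist X).hom ⊗ₘ (twist Y).hom) ≫ (β_ X Y).hom ≫ (β_ Y X).hom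
  twist_dual : ∀ X : C, (twist Xᘁ).hom = ((twist X).hom)ᘁ

namespace EllipticCenter

section
variable {C : Type u} [Category.{v} C] [MonoidalCategory C]

/-- The half-braiding `λ_A : A ⊗ X → X ⊗ A`. Mathlib records its inverse `X ⊗ A → A ⊗ X`. -/
def lam {X : C} (b : HalfBraiding X) (A : C) : A ⊗ X ≅ X ⊗ A := (b.β A).symm

theorem lam_naturality {X : C} (b : HalfBraiding X) {A B : C} (f : A ⟶ B) :
    f ▷ X ≫ (lam b B).hom = (lam b A).hom ≫ X ◁ f := by
  rw [← cancel_epi (lam b A).inv, ← cancel_mono (lam b B).inv]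
  simp [lam]

theorem lam_naturality_inv {X : C} (b : HalfBraiding X) {A B : C} (f : A ⟶ B) :
    X ◁ f ≫ (lam b B).inv = (lam b A).inv ≫ f ▷ X := by
  simp [lam]

theorem lam_tensor {X : C} (b : HalfBraiding X) (A B : C) :
    (lam b (A ⊗ B)).hom = (α_ A B X).hom ≫ A ◁ (lam b B).hom ≫ (α_ A X B).inv ≫
      (lam b A).hom ▷ B ≫ (α_ X A B).hom := by
  apply eq_of_inv_eq_inv
  simp [lam]

theorem lam_tensor_inv {X : C} (b : HalfBraiding X) (A B : C) :
    (lam b (A ⊗ B)).inv = (α_ X A B).inv ≫ (lam b A).inv ▷ B ≫ (α_ A X B).hom ≫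
      A ◁ (lam b B).inv ≫ (α_ A B X).inv := by
  simp [lam]

/-- A half-braiding from `λ_A : A ⊗ X → X ⊗ A`, natural in `A` and multiplicative. -/
def ofLam (X : C) (l : ∀ A : C, A ⊗ X ≅ X ⊗ A)
    (hn : ∀ {A B : C} (f : A ⟶ B), f ▷ X ≫ (l B).hom = (l A).hom ≫ X ◁ f)
    (ht : ∀ A B : C, (l (A ⊗ B)).hom = (α_ A B X).hom ≫ A ◁ (l B).hom ≫ (α_ A X B).inv ≫
      (l A).hom ▷ B ≫ (α_ X A B).hom) : HalfBraiding X where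
  β A := (l A).symm
  monoidal A B := by
    rw [← cancel_epi (l (A ⊗ B)).hom]
    nth_rw 2 [ht A B]
    simp
  naturality f := by
    have := hn f
    simp [Iso.eq_inv_comp, ← reassoc_of% this]

@[simp] theorem lam_ofLam {X : C} (l : ∀ A : C, A ⊗ X ≅ X ⊗ A) (hn) (ht) (A : C) :
    lam (ofLam X l hn ht) A = l A := by simp [lam, ofLam]

theorem lam_braid {X : C} (b : HalfBraiding X) {A B : C} (f : A ⊗ B ≅ B ⊗ A) :
    A ◁ (lam b B).hom ⊗≫ (lam b A).hom ▷ B ⊗≫ X ◁ f.hom =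
    𝟙 _ ⊗≫ f.hom ▷ X ⊗≫ B ◁ (lam b A).hom ⊗≫ (lam b B).hom ▷ A ⊗≫ 𝟙 _ := by
  have := lam_naturality b f.hom
  rw [lam_tensor, lam_tensor] at this
  calc _ = (α_ _ _ _).inv ≫ (((α_ A B X).hom ≫ A ◁ (lam b B).hom ≫ (α_ A X B).inv ≫ (lam b A).hom ▷ B ≫ (α_ X A B).hom) ≫
    X ◁ f.hom) := by simp [monoidalComp]
    _ = _ := by rw [← this]; simp [monoidalComp]

theorem lam_braid_inv {X : C} (b : HalfBraiding X) {A B : C} (f : A ⊗ B ⟶ B ⊗ A) :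
    X ◁ f ⊗≫ (lam b B).inv ▷ A ⊗≫ B ◁ (lam b A).inv =
    𝟙 _ ⊗≫ (lam b A).inv ▷ B ⊗≫ A ◁ (lam b B).inv ⊗≫ f ▷ X ⊗≫ 𝟙 _ := by
  have := lam_naturality_inv b f
  rw [lam_tensor_inv, lam_tensor_inv] at this
  calc _ = (X ◁ f ≫ (α_ X B A).inv ≫ (lam b B).inv ▷ A ≫ (α_ B X A).hom ≫
      B ◁ (lam b A).inv ≫ (α_ B A X).inv) ⊗≫ 𝟙 _ := by monoidal
    _ = _ := by rw [this]; monoidal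

section
variable [BraidedCategory C]

theorem slide_left {P Q R S : C} (g : P ⊗ Q ⟶ R ⊗ S) (B : C) :
    B ◁ g ⊗≫ (β_ B R).hom ▷ S ⊗≫ R ◁ (β_ B S).hom =
      𝟙 _ ⊗≫ (β_ B P).hom ▷ Q ⊗≫ P ◁ (β_ B Q).hom ⊗≫ g ▷ B ⊗≫ 𝟙 _ := by
  have := BraidedCategory.braiding_naturality_right B g
  rw [BraidedCategory.braiding_tensor_right_hom, BraidedCategory.braiding_tensor_right_hom] at this
  calc _ = (B ◁ g ≫ (α_ B R S).inv ≫ (β_ B R).hom ▷ S ≫ (α_ R B S).hom ≫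
        R ◁ (β_ B S).hom ≫ (α_ R S B).inv) ⊗≫ 𝟙 _ := by monoidal
    _ = _ := by rw [this]; monoidal

theorem slide_right {P Q R S : C} (g : P ⊗ Q ⟶ R ⊗ S) (B : C) :
    g ▷ B ⊗≫ R ◁ (β_ S B).hom ⊗≫ (β_ R B).hom ▷ S =
      𝟙 _ ⊗≫ P ◁ (β_ Q B).hom ⊗≫ (β_ P B).hom ▷ Q ⊗≫ B ◁ g ⊗≫ 𝟙 _ := by
  have := BraidedCategory.braiding_naturality_left g B
  rw [BraidedCategory.braiding_tensor_left_hom, BraidedCategory.braiding_tensor_left_hom] at this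
  calc _ = (g ▷ B ≫ (α_ R S B).hom ≫ R ◁ (β_ S B).hom ≫ (α_ R B S).inv ≫
        (β_ R B).hom ▷ S ≫ (α_ B R S).hom) ⊗≫ 𝟙 _ := by monoidal
    _ = _ := by rw [this]; monoidal

theorem slide_left_inv {P Q R S : C} (g : P ⊗ Q ⟶ R ⊗ S) (B : C) :
    B ◁ g ⊗≫ (β_ R B).inv ▷ S ⊗≫ R ◁ (β_ S B).inv =
      𝟙 _ ⊗≫ (β_ P B).inv ▷ Q ⊗≫ P ◁ (β_ Q B).inv ⊗≫ g ▷ B ⊗≫ 𝟙 _ :=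
  letI := reverseBraiding C
  slide_left g B

theorem slide_right_inv {P Q R S : C} (g : P ⊗ Q ⟶ R ⊗ S) (B : C) :
    g ▷ B ⊗≫ R ◁ (β_ B S).inv ⊗≫ (β_ B R).inv ▷ S =
      𝟙 _ ⊗≫ P ◁ (β_ B Q).inv ⊗≫ (β_ B P).inv ▷ Q ⊗≫ B ◁ g ⊗≫ 𝟙 _ :=
  letI := reverseBraiding C
  slide_right g B

theorem dagger_aux {X : C} (b : HalfBraiding X) (A B : C) :
    (β_ X A).inv ▷ B ⊗≫ (lam b A).inv ▷ B ⊗≫ A ◁ (lam b B).inv ⊗≫ A ◁ (β_ B X).hom =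
    𝟙 _ ⊗≫ A ◁ (lam b B).inv ⊗≫ A ◁ (β_ B X).hom ⊗≫ (β_ X A).inv ▷ B ⊗≫
      (lam b A).inv ▷ B ⊗≫ 𝟙 _ := by
  calc
    _ = (β_ X A).inv ▷ B ⊗≫ (lam b A).inv ▷ B ⊗≫ A ◁ (lam b B).inv ⊗≫
          ((β_ B A).inv ≫ (β_ B A).hom) ▷ X ⊗≫ A ◁ (β_ B X).hom := by
      rw [Iso.inv_hom_id]; monoidal
    _ = (β_ X A).inv ▷ B ⊗≫
          (𝟙 (X ⊗ A ⊗ B) ⊗≫ (lam b A).inv ▷ B ⊗≫ A ◁ (lam b B).inv ⊗≫ (β_ B A).inv ▷ X ⊗≫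
            𝟙 (B ⊗ A ⊗ X)) ⊗≫
          (β_ B A).hom ▷ X ⊗≫ A ◁ (β_ B X).hom := by monoidal
    _ = (β_ X A).inv ▷ B ⊗≫
          (X ◁ (β_ B A).inv ⊗≫ (lam b B).inv ▷ A ⊗≫ B ◁ (lam b A).inv) ⊗≫
          (β_ B A).hom ▷ X ⊗≫ A ◁ (β_ B X).hom := by rw [lam_braid_inv]
    _ = (β_ X A).inv ▷ B ⊗≫ X ◁ (β_ B A).inv ⊗≫ (lam b B).inv ▷ A ⊗≫
          (B ◁ (lam b A).inv ⊗≫ (β_ B A).hom ▷ X ⊗≫ A ◁ (β_ B X).hom) := by monoidal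
    _ = 𝟙 _ ⊗≫ (𝟙 (A ⊗ X ⊗ B) ⊗≫ (β_ X A).inv ▷ B ⊗≫ X ◁ (β_ B A).inv ⊗≫ (lam b B).inv ▷ A ⊗≫ 𝟙 (B ⊗ X ⊗ A)) ⊗≫
          (β_ B X).hom ▷ A ⊗≫ X ◁ (β_ B A).hom ⊗≫ (lam b A).inv ▷ B ⊗≫ 𝟙 _ := by
      rw [slide_left]; monoidal
    _ = 𝟙 _ ⊗≫ A ◁ (lam b B).inv ⊗≫ (β_ B A).inv ▷ X ⊗≫ (B ◁ (β_ X A).inv ⊗≫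
          (β_ B X).hom ▷ A ⊗≫ X ◁ (β_ B A).hom) ⊗≫ (lam b A).inv ▷ B ⊗≫ 𝟙 _ := by
      rw [← slide_left_inv]; monoidal
    _ = 𝟙 _ ⊗≫ A ◁ (lam b B).inv ⊗≫ ((β_ B A).inv ≫ (β_ B A).hom) ▷ X ⊗≫ A ◁ (β_ B X).hom ⊗≫
          (β_ X A).inv ▷ B ⊗≫ (lam b A).inv ▷ B ⊗≫ 𝟙 _ := by
      rw [slide_left]; monoidal
    _ = _ := by rw [Iso.inv_hom_id]; monoidal

/-- The half-braiding `λ†`, with `λ†_A = c_{A,X} ∘ λ_A⁻¹ ∘ c_{X,A}⁻¹`. -/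
def dagger {X : C} (b : HalfBraiding X) : HalfBraiding X :=
  ofLam X (fun A => (β_ X A).symm ≪≫ (lam b A).symm ≪≫ β_ A X)
    (fun {A B} f => by simp [reassoc_of% (lam_naturality_inv b f)])
    (fun A B => by
      simp only [Iso.trans_hom, Iso.symm_hom, lam_tensor_inv,
        BraidedCategory.braiding_tensor_left_hom, BraidedCategory.braiding_tensor_right_inv]
      calc
        _ = 𝟙 _ ⊗≫ A ◁ (β_ X B).inv ⊗≫ ((β_ X A).inv ▷ B ⊗≫ (lam b A).inv ▷ B ⊗≫
              A ◁ (lam b B).inv ⊗≫ A ◁ (β_ B X).hom) ⊗≫ (β_ A X).hom ▷ B ⊗≫ 𝟙 _ := by monoidal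
        _ = _ := by rw [dagger_aux]; monoidal)

/-- The inverse operation of `dagger`, with `λ_A ↦ c_{X,A}⁻¹ ∘ λ_A⁻¹ ∘ c_{A,X}`. -/
def daggerInv {X : C} (b : HalfBraiding X) : HalfBraiding X :=
  letI := reverseBraiding C
  dagger b

@[simp] theorem lam_dagger {X : C} (b : HalfBraiding X) (A : C) :
    lam (dagger b) A = (β_ X A).symm ≪≫ (lam b A).symm ≪≫ β_ A X  := lam_ofLam _ _ _ _

@[simp] theorem lam_daggerInv {X : C} (b : HalfBraiding X) (A : C) :
    lam (daggerInv b) A = β_ A X ≪≫ (lam b A).symm ≪≫ (β_ X A).symm :=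
  letI := reverseBraiding C
  lam_dagger b A

/-- The compatibility condition on an ordered pair of half-braidings, as an equality of morphisms
`A ⊗ B ⊗ X → X ⊗ B ⊗ A`; the braiding is on the left, the reverse braiding on the right:
`(1 ⊗ c_{A,B}) (λ¹_A ⊗ 1) (1 ⊗ λ²_B) = (λ²_B ⊗ 1) (1 ⊗ λ¹_A) (c_{B,A}⁻¹ ⊗ 1)`. -/
def Comm {X : C} (b₁ b₂ : HalfBraiding X) : Prop := ∀ A B : C,
  A ◁ (lam b₂ B).hom ≫ (α_ A X B).inv ≫ (lam b₁ A).hom ▷ B ≫ (α_ X A B).hom ≫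
      X ◁ (β_ A B).hom ≫ (α_ X B A).inv =
    (α_ A B X).inv ≫ (β_ B A).inv ▷ X ≫ (α_ B A X).hom ≫ B ◁ (lam b₁ A).hom ≫
      (α_ B X A).inv ≫ (lam b₂ B).hom ▷ A

theorem comm_iff {X : C} (b₁ b₂ : HalfBraiding X) : Comm b₁ b₂ ↔ ∀ A B : C,
    A ◁ (lam b₂ B).hom ⊗≫ (lam b₁ A).hom ▷ B ⊗≫ X ◁ (β_ A B).hom ⊗≫ 𝟙 _ =
      𝟙 _ ⊗≫ (β_ B A).inv ▷ X ⊗≫ B ◁ (lam b₁ A).hom ⊗≫ (lam b₂ B).hom ▷ A := by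
  refine forall₂_congr fun A B => ?_
  simp [monoidalComp]

theorem comm_dagger {X : C} {b₁ b₂ : HalfBraiding X} (h : Comm b₁ b₂) :
    Comm (dagger b₂) b₁ := by
  rw [comm_iff] at h ⊢
  intro A B
  have hM : (lam b₁ B).hom ▷ A ⊗≫ X ◁ (β_ B A).hom ⊗≫ (lam b₂ A).inv ▷ B =
      𝟙 _ ⊗≫ B ◁ (lam b₂ A).inv ⊗≫ (β_ A B).inv ▷ X ⊗≫ A ◁ (lam b₁ B).hom ⊗≫ 𝟙 _ := by
    calc
      _ = 𝟙 _ ⊗≫ B ◁ ((lam b₂ A).inv ≫ (lam b₂ A).hom) ⊗≫ (lam b₁ B).hom ▷ A ⊗≫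
          X ◁ (β_ B A).hom ⊗≫ (lam b₂ A).inv ▷ B := by
        rw [Iso.inv_hom_id]; monoidal
      _ = 𝟙 _ ⊗≫ B ◁ (lam b₂ A).inv ⊗≫ (B ◁ (lam b₂ A).hom ⊗≫ (lam b₁ B).hom ▷ A ⊗≫
          X ◁ (β_ B A).hom ⊗≫ 𝟙 ((X ⊗ A) ⊗ B)) ⊗≫ (lam b₂ A).inv ▷ B := by monoidal
      _ = 𝟙 _ ⊗≫ B ◁ (lam b₂ A).inv ⊗≫ (β_ A B).inv ▷ X ⊗≫ A ◁ (lam b₁ B).hom ⊗≫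
          ((lam b₂ A).hom ≫ (lam b₂ A).inv) ▷ B ⊗≫ 𝟙 _ := by
        rw [h]; monoidal
      _ = _ := by rw [Iso.hom_inv_id]; monoidal
  simp only [lam_dagger, Iso.trans_hom, Iso.symm_hom]
  calc
    _ = (A ◁ (lam b₁ B).hom ⊗≫ (β_ X A).inv ▷ B ⊗≫ X ◁ (β_ B A).inv) ⊗≫ X ◁ (β_ B A).hom ⊗≫
        (lam b₂ A).inv ▷ B ⊗≫ (β_ A X).hom ▷ B ⊗≫ X ◁ (β_ A B).hom ⊗≫ 𝟙 _ := by
      have : X ◁ (β_ B A).inv ≫ X ◁ (β_ B A).hom = 𝟙 _ := by simp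
      calc
        _ = A ◁ (lam b₁ B).hom ⊗≫ (β_ X A).inv ▷ B ⊗≫
            (X ◁ (β_ B A).inv ≫ X ◁ (β_ B A).hom) ⊗≫
            (lam b₂ A).inv ▷ B ⊗≫ (β_ A X).hom ▷ B ⊗≫ X ◁ (β_ A B).hom ⊗≫ 𝟙 _ := by
          rw [this]; monoidal
        _ = _ := by monoidal
    _ = 𝟙 _ ⊗≫ (β_ B A).inv ▷ X ⊗≫ B ◁ (β_ X A).inv ⊗≫ ((lam b₁ B).hom ▷ A ⊗≫
        X ◁ (β_ B A).hom ⊗≫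
        (lam b₂ A).inv ▷ B) ⊗≫ (β_ A X).hom ▷ B ⊗≫ X ◁ (β_ A B).hom ⊗≫ 𝟙 _ := by
      rw [slide_left_inv]; monoidal
    _ = 𝟙 _ ⊗≫ (β_ B A).inv ▷ X ⊗≫ B ◁ (β_ X A).inv ⊗≫ B ◁ (lam b₂ A).inv ⊗≫ (β_ A B).inv ▷ X ⊗≫
        (A ◁ (lam b₁ B).hom ⊗≫ (β_ A X).hom ▷ B ⊗≫ X ◁ (β_ A B).hom) ⊗≫ 𝟙 _ := by
      rw [hM]; monoidal
    _ = 𝟙 _ ⊗≫ (β_ B A).inv ▷ X ⊗≫ B ◁ (β_ X A).inv ⊗≫ B ◁ (lam b₂ A).inv ⊗≫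
        ((β_ A B).inv ≫ (β_ A B).hom) ▷ X ⊗≫ B ◁ (β_ A X).hom ⊗≫ (lam b₁ B).hom ▷ A := by
      rw [slide_left]; monoidal
    _ = _ := by rw [Iso.inv_hom_id]; monoidal

theorem comm_reverse {X : C} {b₁ b₂ : HalfBraiding X} :
    @Comm C _ _ (reverseBraiding C) X b₁ b₂ ↔ Comm b₂ b₁ := by
  have key : ∀ A B : C,
      (B ◁ (lam b₂ A).hom ≫ (α_ B X A).inv ≫ (lam b₁ B).hom ▷ A ≫ (α_ X B A).hom ≫
          X ◁ (β_ A B).inv ≫ (α_ X A B).inv =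
        (α_ B A X).inv ≫ (β_ B A).hom ▷ X ≫ (α_ A B X).hom ≫ A ◁ (lam b₁ B).hom ≫
          (α_ A X B).inv ≫ (lam b₂ A).hom ▷ B) ↔
      (A ◁ (lam b₁ B).hom ≫ (α_ A X B).inv ≫ (lam b₂ A).hom ▷ B ≫ (α_ X A B).hom ≫
          X ◁ (β_ A B).hom ≫ (α_ X B A).inv =
        (α_ A B X).inv ≫ (β_ B A).inv ▷ X ≫ (α_ B A X).hom ≫ B ◁ (lam b₂ A).hom ≫
          (α_ B X A).inv ≫ (lam b₁ B).hom ▷ A) := by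
    intro A B
    rw [← cancel_epi ((α_ A B X).inv ≫ (β_ B A).inv ▷ X ≫ (α_ B A X).hom),
      ← cancel_mono ((α_ X A B).hom ≫ X ◁ (β_ A B).hom ≫ (α_ X B A).inv)]
    simp [← comp_whiskerRight_assoc, ← MonoidalCategory.whiskerLeft_comp_assoc]
    exact eq_comm
  exact ⟨fun h A B => (key A B).1 (h B A), fun h A B => (key B A).2 (h B A)⟩

theorem comm_daggerInv {X : C} {b₁ b₂ : HalfBraiding X} (h : Comm b₁ b₂) :
    Comm b₂ (daggerInv b₁) :=
  comm_reverse.1 (@comm_dagger C _ _ (reverseBraiding C) X b₂ b₁ (comm_reverse.2 h))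

end

section
variable [BraidedCategory C] [RightRigidCategory C] [RibbonCategory C]

open RibbonCategory

/-- The automorphism `λ_A⁻¹ ∘ c_{A,X} ∘ (θ_A ⊗ 1)` of `A ⊗ X`. -/
def loop {X : C} (b : HalfBraiding X) (A : C) : A ⊗ X ≅ A ⊗ X :=
  whiskerRightIso (twist A) X ≪≫ β_ A X ≪≫ (lam b A).symm

theorem loop_naturality {X : C} (b : HalfBraiding X) {A B : C} (f : A ⟶ B) :
    f ▷ X ≫ (loop b B).hom = (loop b A).hom ≫ f ▷ X := by
  simp only [loop, Iso.trans_hom, whiskerRightIso_hom, Iso.symm_hom, Category.assoc,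
    ← lam_naturality_inv, ← BraidedCategory.braiding_naturality_left_assoc]
  simp only [← comp_whiskerRight_assoc, twist_naturality]

/-- `loop b A` on the first and third factors of `A ⊗ B ⊗ X`, moved past `B`. -/
def loopConj {X : C} (b : HalfBraiding X) (A B : C) : A ⊗ (B ⊗ X) ≅ A ⊗ (B ⊗ X) :=
  (α_ A B X).symm ≪≫ whiskerRightIso (β_ A B) X ≪≫ α_ B A X ≪≫ whiskerLeftIso B (loop b A) ≪≫
    (α_ B A X).symm ≪≫ whiskerRightIso (β_ B A) X ≪≫ α_ A B X

end

section
variable [BraidedCategory C]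
theorem loop_tensor_aux {X : C} (b : HalfBraiding X) (A B : C) :
    A ◁ (β_ B X).hom ⊗≫ A ◁ (lam b B).inv ⊗≫ (β_ A B).hom ▷ X ⊗≫ B ◁ (β_ A X).hom ⊗≫
      B ◁ (lam b A).inv ⊗≫ 𝟙 _ =
    𝟙 _ ⊗≫ (β_ (A ⊗ B) X).hom ≫ (lam b (A ⊗ B)).inv ≫ (β_ A B).hom ▷ X := by
  rw [← lam_naturality_inv, BraidedCategory.braiding_tensor_left_hom, lam_tensor_inv]
  calc
    _ = A ◁ (β_ B X).hom ⊗≫ (𝟙 (A ⊗ X ⊗ B) ⊗≫ A ◁ (lam b B).inv ⊗≫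
        (β_ A B).hom ▷ X ⊗≫ B ◁ (β_ A X).hom) ⊗≫
      B ◁ (lam b A).inv ⊗≫ 𝟙 _ := by monoidal
    _ = A ◁ (β_ B X).hom ⊗≫ (𝟙 (A ⊗ X ⊗ B) ⊗≫ (β_ A X).hom ▷ B ⊗≫ X ◁ (β_ A B).hom ⊗≫
          (lam b B).inv ▷ A ⊗≫ 𝟙 (B ⊗ X ⊗ A)) ⊗≫
        B ◁ (lam b A).inv ⊗≫ 𝟙 _ := by
      rw [← slide_left]; monoidal
    _ = _ := by monoidal

end

section
variable [BraidedCategory C] [RightRigidCategory C] [RibbonCategory C]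

open RibbonCategory

theorem loop_tensor {X : C} (b : HalfBraiding X) (A B : C) :
    (loop b (A ⊗ B)).hom =
      (α_ A B X).hom ≫ A ◁ (loop b B).hom ≫ (loopConj b A B).hom ≫ (α_ A B X).inv := by
  have nat : ∀ {A B : C} (f : A ⟶ B), f ▷ X ≫ (β_ B X).hom ≫ (lam b B).inv =
      (β_ A X).hom ≫ (lam b A).inv ≫ f ▷ X := fun f => by
    rw [← lam_naturality_inv, ← BraidedCategory.braiding_naturality_left_assoc]
  have h1 : (β_ (A ⊗ B) X).hom ≫ (lam b (A ⊗ B)).inv ≫ (β_ A B).hom ▷ X =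
      𝟙 _ ⊗≫ A ◁ (β_ B X).hom ⊗≫ A ◁ (lam b B).inv ⊗≫ (β_ A B).hom ▷ X ⊗≫
        B ◁ (β_ A X).hom ⊗≫ B ◁ (lam b A).inv ⊗≫ 𝟙 _ := by
    rw [loop_tensor_aux]; simp [monoidalComp]
  have h2 : A ◁ (lam b B).inv ≫ (twist A).hom ▷ (B ⊗ X) =
      (twist A).hom ▷ (X ⊗ B) ≫ A ◁ (lam b B).inv := whisker_exchange _ _
  have h3 : A ◁ (β_ B X).hom ≫ (twist A).hom ▷ (X ⊗ B) =
      (twist A).hom ▷ (B ⊗ X) ≫ A ◁ (β_ B X).hom := whisker_exchange _ _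
  calc
    _ = ((twist A).hom ⊗ₘ (twist B).hom) ▷ X ≫ ((β_ A B).hom ▷ X ≫ (β_ B A).hom ▷ X ≫
          (β_ (A ⊗ B) X).hom ≫ (lam b (A ⊗ B)).inv) := by
      simp only [loop, Iso.trans_hom, whiskerRightIso_hom, Iso.symm_hom, twist_tensor,
        comp_whiskerRight, Category.assoc]
    _ = ((twist A).hom ⊗ₘ (twist B).hom) ▷ X ≫ ((β_ (A ⊗ B) X).hom ≫ (lam b (A ⊗ B)).inv ≫
          (β_ A B).hom ▷ X) ≫ (β_ B A).hom ▷ X := by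
      rw [nat, reassoc_of% (nat (β_ A B).hom)]; simp only [Category.assoc]
    _ = 𝟙 _ ⊗≫ A ◁ (twist B).hom ▷ X ⊗≫ ((twist A).hom ▷ (B ⊗ X) ≫ A ◁ (β_ B X).hom) ⊗≫
        A ◁ (lam b B).inv ⊗≫ (β_ A B).hom ▷ X ⊗≫
        B ◁ (β_ A X).hom ⊗≫ B ◁ (lam b A).inv ⊗≫ (β_ B A).hom ▷ X ⊗≫ 𝟙 _ := by
      rw [h1, tensorHom_def']; monoidal
    _ = 𝟙 _ ⊗≫ A ◁ (twist B).hom ▷ X ⊗≫ A ◁ (β_ B X).hom ⊗≫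
        ((twist A).hom ▷ (X ⊗ B) ≫ A ◁ (lam b B).inv) ⊗≫ (β_ A B).hom ▷ X ⊗≫
        B ◁ (β_ A X).hom ⊗≫ B ◁ (lam b A).inv ⊗≫ (β_ B A).hom ▷ X ⊗≫ 𝟙 _ := by
      rw [← h3]; monoidal
    _ = 𝟙 _ ⊗≫ A ◁ (twist B).hom ▷ X ⊗≫ A ◁ (β_ B X).hom ⊗≫
        A ◁ (lam b B).inv ⊗≫ ((twist A).hom ▷ B ≫ (β_ A B).hom) ▷ X ⊗≫
        B ◁ (β_ A X).hom ⊗≫ B ◁ (lam b A).inv ⊗≫ (β_ B A).hom ▷ X ⊗≫ 𝟙 _ := by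
      rw [← h2]; monoidal
    _ = _ := by
      rw [BraidedCategory.braiding_naturality_left]
      simp only [loop, loopConj, Iso.trans_hom, whiskerRightIso_hom, Iso.symm_hom,
        whiskerLeftIso_hom]
      monoidal

theorem loop_tensor' {X : C} (b : HalfBraiding X) (A B : C) :
    (loop b (A ⊗ B)).hom =
      (α_ A B X).hom ≫ (loopConj b A B).hom ≫ A ◁ (loop b B).hom ≫ (α_ A B X).inv := by
  have h := loop_naturality b (β_ A B).hom
  rw [loop_tensor b B A] at h
  rw [← cancel_mono ((β_ A B).hom ▷ X), ← h]
  simp [loopConj]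

theorem loop_comm {X : C} {b₁ b₂ : HalfBraiding X} (h : Comm b₁ b₂) (A B : C) :
    (A ◁ (lam b₂ B).hom ≫ (α_ A X B).inv) ≫ (loop b₁ A).hom ▷ B =
      (loopConj b₁ A B).hom ≫ (A ◁ (lam b₂ B).hom ≫ (α_ A X B).inv) := by
  rw [comm_iff] at h
  have h1 : (lam b₂ B).hom ▷ A ⊗≫ X ◁ (β_ A B).inv ⊗≫ (lam b₁ A).inv ▷ B =
      𝟙 _ ⊗≫ B ◁ (lam b₁ A).inv ⊗≫ (β_ B A).hom ▷ X ⊗≫ A ◁ (lam b₂ B).hom ⊗≫ 𝟙 _ := by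
    have h0 := h A B
    simp [monoidalComp] at h0 ⊢
    rw [← cancel_epi ((α_ A B X).inv ≫ (β_ B A).inv ▷ X ≫ (α_ B A X).hom ≫
      B ◁ (lam b₁ A).hom ≫ (α_ B X A).inv)]
    simp [← reassoc_of% h0, ← comp_whiskerRight_assoc, ← MonoidalCategory.whiskerLeft_comp_assoc]
  have h2 : A ◁ (lam b₂ B).hom ≫ (twist A).hom ▷ (X ⊗ B) =
      (twist A).hom ▷ (B ⊗ X) ≫ A ◁ (lam b₂ B).hom := whisker_exchange _ _
  calc
    _ = (A ◁ (lam b₂ B).hom ≫ (twist A).hom ▷ (X ⊗ B)) ⊗≫ (β_ A X).hom ▷ B ⊗≫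
          X ◁ ((β_ A B).hom ≫ (β_ A B).inv) ⊗≫ (lam b₁ A).inv ▷ B := by
      rw [Iso.hom_inv_id]
      simp only [loop, Iso.trans_hom, whiskerRightIso_hom, Iso.symm_hom]
      monoidal
    _ = (twist A).hom ▷ (B ⊗ X) ⊗≫ (A ◁ (lam b₂ B).hom ⊗≫ (β_ A X).hom ▷ B ⊗≫
          X ◁ (β_ A B).hom) ⊗≫ X ◁ (β_ A B).inv ⊗≫ (lam b₁ A).inv ▷ B := by
      rw [h2]; monoidal
    _ = 𝟙 _ ⊗≫ ((twist A).hom ▷ B ≫ (β_ A B).hom) ▷ X ⊗≫ B ◁ (β_ A X).hom ⊗≫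
          ((lam b₂ B).hom ▷ A ⊗≫
          X ◁ (β_ A B).inv ⊗≫ (lam b₁ A).inv ▷ B) := by
      rw [slide_left]; monoidal
    _ = _ := by
      rw [h1, BraidedCategory.braiding_naturality_left]
      simp only [loop, loopConj, Iso.trans_hom, whiskerRightIso_hom, Iso.symm_hom,
        whiskerLeftIso_hom]
      monoidal

theorem loop_comm_inv {X : C} {b₁ b₂ : HalfBraiding X} (h : Comm b₁ b₂) (A B : C) :
    (A ◁ (lam b₂ B).hom ≫ (α_ A X B).inv) ≫ (loop b₁ A).inv ▷ B =
      (loopConj b₁ A B).inv ≫ (A ◁ (lam b₂ B).hom ≫ (α_ A X B).inv) := by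
  have := loop_comm h A B
  rw [Iso.eq_inv_comp, ← cancel_mono ((loop b₁ A).hom ▷ B)]
  simp only [Category.assoc, inv_hom_whiskerRight, Category.comp_id] at this ⊢
  exact this.symm

/-- The half-braiding `λ² ⋉ λ¹`, with
`(λ² ⋉ λ¹)_A = λ²_A ∘ (λ¹_A)⁻¹ ∘ c_{A,X} ∘ (θ_A ⊗ 1)`. -/
def twisted {X : C} (b₂ b₁ : HalfBraiding X) (h : Comm b₁ b₂) : HalfBraiding X :=
  ofLam X (fun A => loop b₁ A ≪≫ lam b₂ A)
    (fun {A B} f => by simp [reassoc_of% (loop_naturality b₁ f), lam_naturality])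
    (fun A B => by
      have := loop_comm h A B
      simp only [Category.assoc] at this
      simp [loop_tensor, lam_tensor, ← reassoc_of% this])

/-- The inverse operation: `λ²_A ∘ (θ_A⁻¹ ⊗ 1) ∘ c_{A,X}⁻¹ ∘ λ¹_A`. -/
def untwisted {X : C} (b₂ b₁ : HalfBraiding X) (h : Comm b₁ b₂) : HalfBraiding X :=
  ofLam X (fun A => (loop b₁ A).symm ≪≫ lam b₂ A)
    (fun {A B} f => by
      have := loop_naturality b₁ f
      simp only [Iso.trans_hom, Iso.symm_hom, Category.assoc, ← lam_naturality,
        Iso.eq_inv_comp, ← reassoc_of% this]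
      simp)
    (fun A B => by
      have := loop_comm_inv h A B
      have h2 : (loop b₁ (A ⊗ B)).inv =
        (α_ A B X).hom ≫ A ◁ (loop b₁ B).inv ≫ (loopConj b₁ A B).inv ≫ (α_ A B X).inv := by
        apply eq_of_inv_eq_inv
        simp [loop_tensor']
      simp only [Category.assoc] at this
      simp [h2, lam_tensor, ← reassoc_of% this])

@[simp] theorem lam_twisted {X : C} {b₂ b₁ : HalfBraiding X} (h : Comm b₁ b₂) (A : C) :
    lam (twisted b₂ b₁ h) A = loop b₁ A ≪≫ lam b₂ A := lam_ofLam _ _ _ _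

@[simp] theorem lam_untwisted {X : C} {b₂ b₁ : HalfBraiding X} (h : Comm b₁ b₂) (A : C) :
    lam (untwisted b₂ b₁ h) A = (loop b₁ A).symm ≪≫ lam b₂ A := lam_ofLam _ _ _ _

theorem loop_key {X : C} (b : HalfBraiding X) (A B : C) :
    (A ◁ (loop b B).hom) ≫ ((α_ A B X).inv ≫ (β_ B A).inv ▷ X ≫ (α_ B A X).hom ≫
      B ◁ (lam b A).hom ≫ (α_ B X A).inv) =
    ((α_ A B X).inv ≫ (β_ B A).inv ▷ X ≫ (α_ B A X).hom ≫
      B ◁ (lam b A).hom ≫ (α_ B X A).inv) ≫ (loop b B).hom ▷ A := by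
  have h1 : (lam b A).hom ▷ B ⊗≫ X ◁ (β_ B A).inv ⊗≫ (lam b B).inv ▷ A =
      𝟙 _ ⊗≫ A ◁ (lam b B).inv ⊗≫ (β_ B A).inv ▷ X ⊗≫ B ◁ (lam b A).hom ⊗≫ 𝟙 _ := by
    have h0 := lam_braid b (β_ B A).symm
    simp [monoidalComp] at h0 ⊢
    rw [← cancel_epi (A ◁ (lam b B).hom ≫ (α_ A X B).inv)]
    simp [reassoc_of% h0, ← MonoidalCategory.whiskerLeft_comp_assoc]
  have h2 : B ◁ (lam b A).hom ≫ (twist B).hom ▷ (X ⊗ A) =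
      (twist B).hom ▷ (A ⊗ X) ≫ B ◁ (lam b A).hom := whisker_exchange _ _
  symm
  calc
    _ = 𝟙 _ ⊗≫ (β_ B A).inv ▷ X ⊗≫ (B ◁ (lam b A).hom ≫ (twist B).hom ▷ (X ⊗ A)) ⊗≫
        (β_ B X).hom ▷ A ⊗≫ X ◁ ((β_ B A).hom ≫ (β_ B A).inv) ⊗≫ (lam b B).inv ▷ A := by
      rw [Iso.hom_inv_id]
      simp only [loop, Iso.trans_hom, whiskerRightIso_hom, Iso.symm_hom]
      monoidal
    _ = 𝟙 _ ⊗≫ ((β_ B A).inv ≫ (twist B).hom ▷ A) ▷ X ⊗≫ (B ◁ (lam b A).hom ⊗≫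
        (β_ B X).hom ▷ A ⊗≫ X ◁ (β_ B A).hom) ⊗≫ X ◁ (β_ B A).inv ⊗≫ (lam b B).inv ▷ A := by
      rw [h2]; monoidal
    _ = 𝟙 _ ⊗≫ A ◁ (twist B).hom ▷ X ⊗≫ ((β_ B A).inv ≫ (β_ B A).hom) ▷ X ⊗≫ A ◁ (β_ B X).hom ⊗≫
        ((lam b A).hom ▷ B ⊗≫ X ◁ (β_ B A).inv ⊗≫ (lam b B).inv ▷ A) := by
      rw [slide_left, ← BraidedCategory.braiding_inv_naturality_right]; monoidal
    _ = _ := by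
      rw [h1, Iso.inv_hom_id]
      simp only [loop, Iso.trans_hom, whiskerRightIso_hom, Iso.symm_hom]
      monoidal

theorem loop_key_inv {X : C} (b : HalfBraiding X) (A B : C) :
    (A ◁ (loop b B).inv) ≫ ((α_ A B X).inv ≫ (β_ B A).inv ▷ X ≫ (α_ B A X).hom ≫
      B ◁ (lam b A).hom ≫ (α_ B X A).inv) =
    ((α_ A B X).inv ≫ (β_ B A).inv ▷ X ≫ (α_ B A X).hom ≫
      B ◁ (lam b A).hom ≫ (α_ B X A).inv) ≫ (loop b B).inv ▷ A := by
  have := loop_key b A B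
  rw [← cancel_epi (A ◁ (loop b B).hom), ← cancel_mono ((loop b B).hom ▷ A)]
  simp only [Category.assoc] at this ⊢
  simp [this]

theorem comm_twisted {X : C} {b₂ b₁ : HalfBraiding X} (h : Comm b₁ b₂) :
    Comm b₁ (twisted b₂ b₁ h) := by
  intro A B
  have := loop_key b₁ A B
  simp only [Category.assoc] at this
  simp [h A B, reassoc_of% this]

theorem comm_untwisted {X : C} {b₂ b₁ : HalfBraiding X} (h : Comm b₁ b₂) :
    Comm b₁ (untwisted b₂ b₁ h) := by
  intro A B
  have := loop_key_inv b₁ A B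
  simp only [Category.assoc] at this
  simp [h A B, reassoc_of% this]

end
end

section Center
variable (C : Type u) [Category.{v} C] [MonoidalCategory C] [BraidedCategory C]

/-- Objects `(X, λ¹, λ²)` of the elliptic Drinfeld center. -/
structure ZEl where
  obj : C
  hb₁ : HalfBraiding obj
  hb₂ : HalfBraiding obj
  comm : Comm hb₁ hb₂

end Center

section Center
variable {C : Type u} [Category.{v} C] [MonoidalCategory C]

/-- `f` intertwines the half-braidings `b` and `b'`. -/
def Intertwines {X Y : C} (f : X ⟶ Y) (b : HalfBraiding X) (b' : HalfBraiding Y) : Prop :=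
  ∀ A : C, (lam b A).hom ≫ f ▷ A = A ◁ f ≫ (lam b' A).hom

theorem intertwines_id {X : C} (b : HalfBraiding X) : Intertwines (𝟙 X) b b := by
  intro A; simp

theorem Intertwines.comp {X Y Z : C} {f : X ⟶ Y} {g : Y ⟶ Z} {b : HalfBraiding X}
    {b' : HalfBraiding Y} {b'' : HalfBraiding Z} (hf : Intertwines f b b')
    (hg : Intertwines g b' b'') : Intertwines (f ≫ g) b b'' := by
  intro A
  rw [comp_whiskerRight, reassoc_of% (hf A), hg A, MonoidalCategory.whiskerLeft_comp_assoc]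

theorem Intertwines.inv {X Y : C} {f : X ⟶ Y} {b : HalfBraiding X} {b' : HalfBraiding Y}
    (hf : Intertwines f b b') (A : C) :
    (lam b A).inv ≫ A ◁ f = f ▷ A ≫ (lam b' A).inv := by
  rw [Iso.inv_comp_eq, ← Category.assoc, Iso.eq_comp_inv, hf A]

variable [BraidedCategory C]

theorem Intertwines.dagger {X Y : C} {f : X ⟶ Y} {b : HalfBraiding X} {b' : HalfBraiding Y}
    (hf : Intertwines f b b') : Intertwines f (dagger b) (dagger b') := by
  intro A
  simp only [lam_dagger, Iso.trans_hom, Iso.symm_hom, Category.assoc,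
    ← BraidedCategory.braiding_naturality_right, reassoc_of% hf.inv A,
    ← BraidedCategory.braiding_inv_naturality_right_assoc]

theorem Intertwines.daggerInv {X Y : C} {f : X ⟶ Y} {b : HalfBraiding X} {b' : HalfBraiding Y}
    (hf : Intertwines f b b') : Intertwines f (daggerInv b) (daggerInv b') :=
  letI := reverseBraiding C
  hf.dagger

section
variable [RightRigidCategory C] [RibbonCategory C]

theorem Intertwines.loop_hom {X Y : C} {f : X ⟶ Y} {b : HalfBraiding X}
    {b' : HalfBraiding Y} (hf : Intertwines f b b') (A : C) :
    (loop b A).hom ≫ A ◁ f = A ◁ f ≫ (loop b' A).hom := by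
  simp [loop, hf.inv A, whisker_exchange_assoc]

theorem Intertwines.loop_inv {X Y : C} {f : X ⟶ Y} {b : HalfBraiding X}
    {b' : HalfBraiding Y} (hf : Intertwines f b b') (A : C) :
    (loop b A).inv ≫ A ◁ f = A ◁ f ≫ (loop b' A).inv := by
  rw [Iso.inv_comp_eq, ← Category.assoc, Iso.eq_comp_inv, hf.loop_hom A]

end

namespace ZEl

/-- Morphisms of `C` that intertwine both half-braidings. -/
@[ext] structure Hom (X Y : ZEl C) where
  f : X.obj ⟶ Y.obj
  comm₁ : Intertwines f X.hb₁ Y.hb₁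
  comm₂ : Intertwines f X.hb₂ Y.hb₂

instance : Category (ZEl C) where
  Hom := Hom
  id X := ⟨𝟙 X.obj, intertwines_id _, intertwines_id _⟩
  comp F G := ⟨F.f ≫ G.f, F.comm₁.comp G.comm₁, F.comm₂.comp G.comm₂⟩

@[ext] theorem hom_ext {X Y : ZEl C} {F G : X ⟶ Y} (h : F.f = G.f) : F = G :=
  Hom.ext h

@[simp] theorem id_f (X : ZEl C) : Hom.f (𝟙 X) = 𝟙 X.obj := rfl

@[simp] theorem comp_f {X Y Z : ZEl C} (F : X ⟶ Y) (G : Y ⟶ Z) : (F ≫ G).f = F.f ≫ G.f := rfl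

/-- The identity of `X`, as an isomorphism between `(X, λ¹, λ²)` and `(X, μ¹, μ²)` when the
half-braidings agree. -/
def idIso {X : C} {b₁ b₂ b₁' b₂' : HalfBraiding X} (h : Comm b₁ b₂) (h' : Comm b₁' b₂')
    (e₁ : ∀ A, lam b₁ A = lam b₁' A) (e₂ : ∀ A, lam b₂ A = lam b₂' A) :
    (⟨X, b₁, b₂, h⟩ : ZEl C) ≅ ⟨X, b₁', b₂', h'⟩ where
  hom := ⟨𝟙 X, fun A => by simp [e₁], fun A => by simp [e₂]⟩
  inv := ⟨𝟙 X, fun A => by simp [e₁], fun A => by simp [e₂]⟩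
  hom_inv_id := by ext; simp
  inv_hom_id := by ext; simp

/-- `U_s : (X, λ¹, λ²) ↦ (X, (λ²)†, λ¹)`, the identity on underlying morphisms. -/
def Us : ZEl C ≌ ZEl C where
  functor :=
    { obj := fun X => ⟨X.obj, dagger X.hb₂, X.hb₁, comm_dagger X.comm⟩
      map := fun F => ⟨F.f, F.comm₂.dagger, F.comm₁⟩ }
  inverse :=
    { obj := fun X => ⟨X.obj, X.hb₂, daggerInv X.hb₁, comm_daggerInv X.comm⟩
      map := fun F => ⟨F.f, F.comm₂, F.comm₁.daggerInv⟩ }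
  unitIso := NatIso.ofComponents
    (fun X => idIso X.comm _ (fun _ => rfl) (fun A => by ext; simp))
    (fun F => by ext; simp [idIso])
  counitIso := NatIso.ofComponents
    (fun X => idIso _ X.comm (fun A => by ext; simp) (fun _ => rfl))
    (fun F => by ext; simp [idIso])
  functor_unitIso_comp X := by ext; simp [idIso]

section
variable [RightRigidCategory C] [RibbonCategory C]

/-- `U_t : (X, λ¹, λ²) ↦ (X, λ¹, λ² ⋉ λ¹)`, the identity on underlying morphisms. -/
def Ut : ZEl C ≌ ZEl C where
  functor :=
    { obj := fun X => ⟨X.obj, X.hb₁, twisted X.hb₂ X.hb₁ X.comm, comm_twisted X.comm⟩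
      map := fun F => ⟨F.f, F.comm₁, fun A => by
        simp [F.comm₂ A, reassoc_of% (F.comm₁.loop_hom A)]⟩ }
  inverse :=
    { obj := fun X => ⟨X.obj, X.hb₁, untwisted X.hb₂ X.hb₁ X.comm, comm_untwisted X.comm⟩
      map := fun F => ⟨F.f, F.comm₁, fun A => by
        simp [F.comm₂ A, reassoc_of% (F.comm₁.loop_inv A)]⟩ }
  unitIso := NatIso.ofComponents
    (fun X => idIso X.comm _ (fun _ => rfl) (fun A => by ext; simp))
    (fun F => by ext; simp [idIso])
  counitIso := NatIso.ofComponents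
    (fun X => idIso _ X.comm (fun _ => rfl) (fun A => by ext; simp))
    (fun F => by ext; simp [idIso])
  functor_unitIso_comp X := by ext; simp [idIso]

end
end ZEl

section
variable [RightRigidCategory C] [RibbonCategory C]
open RibbonCategory

/-- The evaluation `X ⊗ X* → 1`, which uses the pivotal structure of the ribbon category. -/
def evTilde (X : C) : X ⊗ Xᘁ ⟶ 𝟙_ C :=
  (twist X).hom ▷ Xᘁ ≫ (β_ X Xᘁ).hom ≫ ε_ X Xᘁ

/-- The endomorphism `(1_X ⊗ ev~_X) ∘ (λ_X ⊗ 1) ∘ (1_X ⊗ coev_X)` of `X`: a kink in the strand of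
`X` whose self-crossing is the half-braiding. -/
def curl {X : C} (b : HalfBraiding X) : X ⟶ X :=
  (ρ_ X).inv ≫ X ◁ η_ X Xᘁ ≫ (α_ X X Xᘁ).inv ≫ (lam b X).hom ▷ Xᘁ ≫ (α_ X X Xᘁ).hom ≫
    X ◁ evTilde X ≫ (ρ_ X).hom

end
end Center

section Action

variable {ι : Type*} {ρ : Type*} {𝒜 : Type u} [Category.{v} 𝒜]

/-- Unreduced words in the generators (`true`) and their formal inverses (`false`). -/
abbrev Word (ι : Type*) := List (ι × Bool)

/-- `U_a` for a letter `a`. -/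
def letterFunctor (U : ι → (𝒜 ≌ 𝒜)) : ι × Bool → (𝒜 ⥤ 𝒜)
  | (i, true) => (U i).functor
  | (i, false) => (U i).inverse

/-- `U_w = U_{a₁} ∘ ⋯ ∘ U_{aₙ}` for a word `w = a₁ ⋯ aₙ`. -/
def wordFunctor (U : ι → (𝒜 ≌ 𝒜)) : Word ι → (𝒜 ⥤ 𝒜)
  | [] => 𝟭 𝒜
  | a :: w => wordFunctor U w ⋙ letterFunctor U a

/-- The canonical identification `U_{xy} = U_x ∘ U_y`. -/
def appendIso (U : ι → (𝒜 ≌ 𝒜)) : ∀ x y : Word ι,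
    wordFunctor U (x ++ y) ≅ wordFunctor U y ⋙ wordFunctor U x
  | [], y => (Functor.rightUnitor (wordFunctor U y)).symm
  | a :: x, y => Functor.isoWhiskerRight (appendIso U x y) (letterFunctor U a) ≪≫
      Functor.associator _ _ _

/-- The canonical isomorphism `U_a ∘ U_{a⁻¹} ≅ 1` for a letter `a`. -/
def cancelIso (U : ι → (𝒜 ≌ 𝒜)) : ∀ a : ι × Bool,
    letterFunctor U (a.1, !a.2) ⋙ letterFunctor U a ≅ 𝟭 𝒜
  | (i, true) => (U i).counitIso
  | (i, false) => (U i).unitIso.symm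

/-- A family of relations `lhs r = rhs r` between words. -/
structure Relations (ι ρ : Type*) where
  lhs : ρ → Word ι
  rhs : ρ → Word ι

/-- Elementary moves between words: a relation `lhs r → rhs r`, or a trivial relation
`a a⁻¹ → 1`, applied inside a word. -/
inductive Move (R : Relations ι ρ) : Word ι → Word ι → Type _
  | rel (x : Word ι) (r : ρ) (y : Word ι) : Move R (x ++ (R.lhs r ++ y)) (x ++ (R.rhs r ++ y))
  | cancel (x : Word ι) (a : ι × Bool) (y : Word ι) :
      Move R (x ++ ([a, (a.1, !a.2)] ++ y)) (x ++ ([] ++ y))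

/-- Finite sequences of moves and reversed moves. -/
inductive Path (R : Relations ι ρ) : Word ι → Word ι → Type _
  | nil (w : Word ι) : Path R w w
  | fwd {w₁ w₂ w₃ : Word ι} (m : Move R w₁ w₂) (p : Path R w₂ w₃) : Path R w₁ w₃
  | bwd {w₁ w₂ w₃ : Word ι} (m : Move R w₂ w₁) (p : Path R w₂ w₃) : Path R w₁ w₃

/-- `U_x e U_y : U_{x v y} ≅ U_{x v' y}`. -/
def whiskerIso (U : ι → (𝒜 ≌ 𝒜)) (x y : Word ι) {v v' : Word ι}
    (e : wordFunctor U v ≅ wordFunctor U v') :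
    wordFunctor U (x ++ (v ++ y)) ≅ wordFunctor U (x ++ (v' ++ y)) :=
  appendIso U x (v ++ y) ≪≫
    Functor.isoWhiskerRight (appendIso U v y ≪≫ Functor.isoWhiskerLeft (wordFunctor U y) e ≪≫
      (appendIso U v' y).symm) (wordFunctor U x) ≪≫
    (appendIso U x (v' ++ y)).symm

/-- The natural isomorphism given by a move. -/
def Move.iso {R : Relations ι ρ} (U : ι → (𝒜 ≌ 𝒜))
    (γ : ∀ r, wordFunctor U (R.lhs r) ≅ wordFunctor U (R.rhs r)) :
    ∀ {w w' : Word ι}, Move R w w' → (wordFunctor U w ≅ wordFunctor U w')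
  | _, _, .rel x r y => whiskerIso U x y (γ r)
  | _, _, .cancel x a y => whiskerIso U x y (v := [a, (a.1, !a.2)]) (v' := []) (cancelIso U a)

/-- The natural isomorphism given by a sequence of moves. -/
def Path.iso {R : Relations ι ρ} (U : ι → (𝒜 ≌ 𝒜))
    (γ : ∀ r, wordFunctor U (R.lhs r) ≅ wordFunctor U (R.rhs r)) :
    ∀ {w w' : Word ι}, Path R w w' → (wordFunctor U w ≅ wordFunctor U w')
  | _, _, .nil w => Iso.refl _
  | _, _, .fwd m p => m.iso U γ ≪≫ p.iso U γ
  | _, _, .bwd m p => (m.iso U γ).symm ≪≫ p.iso U γ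

/-- `G` is presented by the generators `gen` and the relations `R`. -/
def IsPresentation {G : Type*} [Group G] (gen : ι → G) (R : Relations ι ρ) : Prop :=
  Function.Surjective (FreeGroup.lift gen) ∧
    (FreeGroup.lift gen).ker = Subgroup.normalClosure
      (Set.range fun r => FreeGroup.mk (R.lhs r) * (FreeGroup.mk (R.rhs r))⁻¹)

/-- The autoequivalences `U` and the natural isomorphisms `γ` form an action of the group `G` by
generators and relations: `G` has the presentation `⟨gen | R⟩`, and any two sequences of moves
between the same words give the same natural isomorphism. -/
def IsGroupAction {G : Type*} [Group G] (gen : ι → G) (R : Relations ι ρ) (U : ι → (𝒜 ≌ 𝒜))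
    (γ : ∀ r, wordFunctor U (R.lhs r) ≅ wordFunctor U (R.rhs r)) : Prop :=
  IsPresentation gen R ∧ ∀ (w w' : Word ι) (p q : Path R w w'), p.iso U γ = q.iso U γ

end Action

/-- The two generators of `SL₂(ℤ)`. -/
inductive SL2Gen
  | s
  | t

/-- The two relations of `SL₂(ℤ)`. -/
inductive SL2Rel
  | r₁
  | r₂

/-- `s = (0 -1; 1 0)` and `t = (1 1; 0 1)`. -/
def slGen : SL2Gen → Matrix.SpecialLinearGroup (Fin 2) ℤ
  | .s => ⟨!![0, -1; 1, 0], by simp [Matrix.det_fin_two]⟩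
  | .t => ⟨!![1, 1; 0, 1], by simp [Matrix.det_fin_two]⟩

/-- `r₁ : s s s s = 1` and `r₂ : s t s = t⁻¹ s t⁻¹`. -/
def slRel : Relations SL2Gen SL2Rel where
  lhs
    | .r₁ => [(.s, true), (.s, true), (.s, true), (.s, true)]
    | .r₂ => [(.s, true), (.t, true), (.s, true)]
  rhs
    | .r₁ => []
    | .r₂ => [(.t, false), (.s, true), (.t, false)]

section
variable (C : Type u) [Category.{v} C] [MonoidalCategory C] [BraidedCategory C]
  [RightRigidCategory C] [RibbonCategory C]

/-- The autoequivalences attached to the generators. -/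
def slAct : SL2Gen → (ZEl C ≌ ZEl C)
  | .s => ZEl.Us
  | .t => ZEl.Ut
end

section
open Limits
attribute [local instance] Abelian.hasFiniteBiproducts

/-- `C`, a `k`-linear ribbon category, is a fusion category: `Hom` spaces are finite dimensional,
the unit is simple, and every object is a finite direct sum of members of a fixed finite list of
simple objects. -/
class IsPremodular (k : Type*) [Field k] (C : Type u) [Category.{v} C] [Abelian C] [Linear k C]
    [MonoidalCategory C] [MonoidalPreadditive C] [MonoidalLinear k C] [RigidCategory C]
    [BraidedCategory C] [RibbonCategory C] : Prop where
  finite_hom : ∀ X Y : C, Module.Finite k (X ⟶ Y)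
  simple_unit : Simple (𝟙_ C)
  semisimple : ∃ (n : ℕ) (S : Fin n → C), (∀ i, Simple (S i)) ∧
    ∀ X : C, ∃ (m : ℕ) (f : Fin m → Fin n), Nonempty (X ≅ ⨁ fun j => S (f j))

end

end EllipticCenter

open EllipticCenter

/-! An object with one half-braiding `λ` lies in the Drinfeld center, which has a twist `T`. It is
characterized on vectors `k : 𝟙_ ⟶ X ⊗ Z`: undoing `λ_Z` on `k` is the pivotal rotation of `k`
followed by `T` (`IsTwist`). Duality makes `T` unique, natural and invertible. `curl` is this twist
(`isTwist_curl`), and on tensor products it obeys the balancing formula (`isTwist_tensorLam`). These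
facts yield what is needed about `γ₂`: the curl commutes with its half-braiding, `†` inverts it
(`curl_dagger`), and `⋉` multiplies curls (`curl_twisted_dagger`). The compatibility condition says
that `(λ¹_A)⁻¹ ∘ λ²_A` is a morphism `(A, c⁻¹) ⊗ (X, λ¹) ⟶ (A, c) ⊗ (X, λ¹)` of the Drinfeld center.
Naturality of the twist at this morphism makes `γ₂` intertwine (`curl_exchange`). For `γ₁`,
naturality of `θ` at `λ_A` suffices.

For coherence put `u = st`. The relations become `s⁴ = 1` and `u³ = s²`, so words have normal forms
in the amalgam of `ℤ/4` and `ℤ/6` over `ℤ/2`. Choose isomorphisms `κ` from a letter applied to a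
normal form to the normal form of the product. Composing them gives an isomorphism from each word to
its normal form (`toNormal`). If every move is compatible with these, the isomorphism of a sequence
of moves depends only on its ends. Trivial moves are compatible by construction, `r₁` by `κS_four`,
and `r₂` by `κU_three`. The last needs only naturality and two identities, `δ (u p) = (τ p)⁻¹ * δ p`
and `τ (s² p) = (τ p)⁻¹`, where `δ : u³ ≅ s²` comes from `γ₂` and `τ` measures how `u` fails to
commute with `s²`. Both are curl identities.

The same argument with trivial morphisms shows that, in any group where the relations hold, each
word equals its normal form. Signs of matrix entries show that only the trivial normal form is `1`
in `SL₂(ℤ)`, which gives the presentation. -/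

namespace EllipticCenter

/-! ### Rotation of vectors, and twists in the Drinfeld center. -/

section
variable {C : Type u} [Category.{v} C] [MonoidalCategory C] [BraidedCategory C]
  [RightRigidCategory C] [RibbonCategory C]

open RibbonCategory

/-- Since the unit braids trivially with itself, `twist_tensor` makes its twist idempotent; being
invertible, it is the identity. -/
theorem twist_unit : (twist (𝟙_ C)).hom = 𝟙 (𝟙_ C) := by
  have h := twist_tensor (𝟙_ C) (𝟙_ C)
  have h2 := twist_naturality (λ_ (𝟙_ C)).hom
  rw [h, MonoidalCategory.tensorHom_def] at h2
  have h3 : (β_ (𝟙_ C) (𝟙_ C)).hom ≫ (β_ (𝟙_ C) (𝟙_ C)).hom = 𝟙 _ := by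
    have : (ρ_ (𝟙_ C)).hom ≫ (λ_ (𝟙_ C)).inv = 𝟙 _ := by rw [← unitors_equal, Iso.hom_inv_id]
    simp [braiding_tensorUnit_right, this]
  rw [h3] at h2
  simp only [Category.comp_id, Category.assoc, leftUnitor_naturality] at h2
  rw [← Category.assoc, cancel_mono, unitors_equal, rightUnitor_naturality,
    ← cancel_epi (ρ_ (𝟙_ C)).inv] at h2
  simp only [Iso.inv_hom_id_assoc] at h2
  simpa using h2.symm

/-- The image of a vector of `X ⊗ Z` under the rotation of the pivotal structure. -/
def rot {X Z : C} (k : 𝟙_ C ⟶ X ⊗ Z) : 𝟙_ C ⟶ Z ⊗ X := k ≫ (β_ X Z).hom ≫ Z ◁ (twist X).hom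

theorem rot_comp_whiskerRight {X Y Z : C} (k : 𝟙_ C ⟶ X ⊗ Z) (f : X ⟶ Y) :
    rot (k ≫ f ▷ Z) = rot k ≫ Z ◁ f := by
  simp only [rot, Category.assoc, BraidedCategory.braiding_naturality_left_assoc,
    ← MonoidalCategory.whiskerLeft_comp, twist_naturality]

theorem rot_comp_whiskerLeft {X Z W : C} (k : 𝟙_ C ⟶ X ⊗ Z) (g : Z ⟶ W) :
    rot (k ≫ X ◁ g) = rot k ≫ g ▷ X := by
  simp only [rot, Category.assoc, BraidedCategory.braiding_naturality_right_assoc,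
    whisker_exchange]

theorem exists_rot_eq {X Z : C} (m : 𝟙_ C ⟶ Z ⊗ X) : ∃ k : 𝟙_ C ⟶ X ⊗ Z, rot k = m :=
  ⟨m ≫ Z ◁ (twist X).inv ≫ (β_ X Z).inv, by simp [rot]⟩

-- By duality every vector of `X ⊗ Z` comes from the coevaluation, so naturality reduces statements
-- about all vectors to that one.
omit [BraidedCategory C] [RibbonCategory C] in
theorem exists_coevaluation_comp {X Z : C} (k : 𝟙_ C ⟶ X ⊗ Z) :
    ∃ m : Xᘁ ⟶ Z, k = η_ X Xᘁ ≫ X ◁ m := by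
  refine ⟨(ρ_ _).inv ≫ Xᘁ ◁ k ⊗≫ ε_ X Xᘁ ▷ Z ⊗≫ 𝟙 Z, ?_⟩
  symm
  calc
    _ = 𝟙 _ ⊗≫ (η_ X Xᘁ ▷ 𝟙_ C ≫ (X ⊗ Xᘁ) ◁ k) ⊗≫ X ◁ ε_ X Xᘁ ▷ Z ⊗≫ 𝟙 _ := by monoidal
    _ = 𝟙 _ ⊗≫ k ⊗≫ (η_ X Xᘁ ▷ X ⊗≫ X ◁ ε_ X Xᘁ) ▷ Z ⊗≫ 𝟙 _ := by
      rw [← whisker_exchange]; monoidal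
    _ = _ := by rw [ExactPairing.evaluation_coevaluation'']; monoidal

/-- For the coevaluation this is `twist_dual`. It is the only place where that axiom enters. -/
theorem comp_twist_whiskerRight {X Z : C} (k : 𝟙_ C ⟶ X ⊗ Z) :
    k ≫ (twist X).hom ▷ Z = k ≫ X ◁ (twist Z).hom := by
  obtain ⟨m, rfl⟩ := exists_coevaluation_comp k
  have h := coevaluation_comp_rightAdjointMate (twist X).hom
  rw [← twist_dual] at h
  rw [Category.assoc, whisker_exchange, ← reassoc_of% h, Category.assoc,
    ← MonoidalCategory.whiskerLeft_comp, ← MonoidalCategory.whiskerLeft_comp, twist_naturality]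

theorem comp_twist_braiding_braiding {X Z : C} (k : 𝟙_ C ⟶ X ⊗ Z) :
    k ≫ (twist X).hom ▷ Z ≫ X ◁ (twist Z).hom ≫ (β_ X Z).hom ≫ (β_ Z X).hom = k := by
  have h := twist_naturality k
  rw [twist_unit, Category.id_comp, twist_tensor, MonoidalCategory.tensorHom_def] at h
  simpa using h

/-- The twist of `X ⊗ Z` is trivial on vectors, so the positive crossing with `θ_X` can be traded
for the negative crossing with `θ_Z⁻¹`. -/
theorem rot_eq {X Z : C} (k : 𝟙_ C ⟶ X ⊗ Z) :
    rot k = k ≫ (β_ Z X).inv ≫ (twist Z).inv ▷ X := by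
  nth_rw 2 [← comp_twist_braiding_braiding k]
  simp [rot]

/-- Rotating `X` and then `Y` braids them fully around each other; this double braiding is the one
in the twist of `X ⊗ Y`. -/
theorem rot_tensor {X Y Z : C} (k : 𝟙_ C ⟶ (X ⊗ Y) ⊗ Z) :
    rot k = rot (rot (k ≫ (α_ X Y Z).hom) ≫ (α_ Y Z X).hom) ≫ (α_ Z X Y).hom := by
  have h : (twist (X ⊗ Y)).hom =
      (β_ X Y).hom ≫ Y ◁ (twist X).hom ≫ (β_ Y X).hom ≫ X ◁ (twist Y).hom := by
    rw [twist_tensor, MonoidalCategory.tensorHom_def, Category.assoc,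
      BraidedCategory.braiding_naturality_right_assoc, BraidedCategory.braiding_naturality_left,
      BraidedCategory.braiding_naturality_left_assoc]
  simp only [rot, h, BraidedCategory.braiding_tensor_left_hom,
    BraidedCategory.braiding_tensor_right_hom, Category.assoc]
  congr 1
  symm
  calc
    _ = 𝟙 _ ⊗≫ (β_ X Y).hom ▷ Z ⊗≫ Y ◁ (β_ X Z).hom ⊗≫ ((Y ⊗ Z) ◁ (twist X).hom ≫
        (β_ Y Z).hom ▷ X) ⊗≫ Z ◁ (β_ Y X).hom ⊗≫ Z ◁ X ◁ (twist Y).hom ⊗≫ 𝟙 _ := by monoidal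
    _ = 𝟙 _ ⊗≫ ((β_ X Y).hom ▷ Z ⊗≫ Y ◁ (β_ X Z).hom ⊗≫ (β_ Y Z).hom ▷ X) ⊗≫
        Z ◁ Y ◁ (twist X).hom ⊗≫ Z ◁ (β_ Y X).hom ⊗≫ Z ◁ X ◁ (twist Y).hom ⊗≫ 𝟙 _ := by
      rw [whisker_exchange]; monoidal
    _ = _ := by rw [slide_right]; monoidal

/-- `T` is the twist of the object `X` with the half-braiding `l` of the Drinfeld center. -/
def IsTwist {X : C} (l : ∀ Z : C, Z ⊗ X ≅ X ⊗ Z) (T : X ⟶ X) : Prop :=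
  ∀ (Z : C) (k : 𝟙_ C ⟶ X ⊗ Z), k ≫ (l Z).inv = rot k ≫ Z ◁ T

omit [RibbonCategory C] in
theorem exists_comp_whiskerLeft {X Y : C} (m : 𝟙_ C ⟶ Xᘁ ⊗ Y) :
    letI := BraidedCategory.exactPairing_swap X Xᘁ
    ∃ g : X ⟶ Y, η_ Xᘁ X ≫ Xᘁ ◁ g = m := by
  let := BraidedCategory.exactPairing_swap X Xᘁ
  refine ⟨𝟙 _ ⊗≫ X ◁ m ⊗≫ ε_ Xᘁ X ▷ Y ⊗≫ 𝟙 _, ?_⟩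
  calc
    _ = 𝟙 _ ⊗≫ (η_ Xᘁ X ▷ 𝟙_ C ≫ (Xᘁ ⊗ X) ◁ m) ⊗≫ Xᘁ ◁ ε_ Xᘁ X ▷ Y ⊗≫ 𝟙 _ := by monoidal
    _ = 𝟙 _ ⊗≫ m ⊗≫ (η_ Xᘁ X ▷ Xᘁ ⊗≫ Xᘁ ◁ ε_ Xᘁ X) ▷ Y ⊗≫ 𝟙 _ := by
      rw [← whisker_exchange]; monoidal
    _ = _ := by rw [ExactPairing.evaluation_coevaluation'']; monoidal

omit [RibbonCategory C] in
theorem exists_comp_whiskerRight {X Z : C} (m : 𝟙_ C ⟶ Z ⊗ X) :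
    letI := BraidedCategory.exactPairing_swap X Xᘁ
    ∃ n : Xᘁ ⟶ Z, m = η_ Xᘁ X ≫ n ▷ X := by
  let := BraidedCategory.exactPairing_swap X Xᘁ
  refine ⟨𝟙 _ ⊗≫ m ▷ Xᘁ ⊗≫ Z ◁ ε_ Xᘁ X ⊗≫ 𝟙 _, ?_⟩
  symm
  calc
    _ = 𝟙 _ ⊗≫ (𝟙_ C ◁ η_ Xᘁ X ≫ m ▷ (Xᘁ ⊗ X)) ⊗≫ Z ◁ ε_ Xᘁ X ▷ X ⊗≫ 𝟙 _ := by monoidal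
    _ = 𝟙 _ ⊗≫ m ⊗≫ Z ◁ (X ◁ η_ Xᘁ X ⊗≫ ε_ Xᘁ X ▷ X) ⊗≫ 𝟙 _ := by
      rw [whisker_exchange]; monoidal
    _ = _ := by rw [ExactPairing.coevaluation_evaluation'']; monoidal

/-- The snake identity recovers a morphism from its effect on the coevaluation of the swapped
pairing, and that vector is a rotation. -/
theorem eq_of_comp_whiskerLeft {X Y : C} {f g : X ⟶ Y}
    (h : ∀ (Z : C) (k : 𝟙_ C ⟶ X ⊗ Z), rot k ≫ Z ◁ f = rot k ≫ Z ◁ g) : f = g := by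
  let := BraidedCategory.exactPairing_swap X Xᘁ
  have key : ∀ f : X ⟶ Y, f = 𝟙 _ ⊗≫ X ◁ (η_ Xᘁ X ≫ Xᘁ ◁ f) ⊗≫ ε_ Xᘁ X ▷ Y ⊗≫ 𝟙 _ := by
    intro f
    symm
    calc
      _ = 𝟙 _ ⊗≫ X ◁ η_ Xᘁ X ⊗≫ ((X ⊗ Xᘁ) ◁ f ≫ ε_ Xᘁ X ▷ Y) ⊗≫ 𝟙 _ := by monoidal
      _ = 𝟙 _ ⊗≫ (X ◁ η_ Xᘁ X ⊗≫ ε_ Xᘁ X ▷ X) ⊗≫ f := by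
        rw [whisker_exchange]; monoidal
      _ = _ := by rw [ExactPairing.coevaluation_evaluation'']; monoidal
  obtain ⟨k, hk⟩ := exists_rot_eq (η_ Xᘁ X)
  rw [key f, key g, ← hk, h]

theorem IsTwist.naturality {X Y : C} {l : ∀ Z : C, Z ⊗ X ≅ X ⊗ Z} {l' : ∀ Z : C, Z ⊗ Y ≅ Y ⊗ Z}
    {T : X ⟶ X} {T' : Y ⟶ Y} (h : IsTwist l T) (h' : IsTwist l' T') (φ : X ⟶ Y)
    (hφ : ∀ Z, (l Z).hom ≫ φ ▷ Z = Z ◁ φ ≫ (l' Z).hom) : T ≫ φ = φ ≫ T' := by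
  refine eq_of_comp_whiskerLeft fun Z k => ?_
  rw [MonoidalCategory.whiskerLeft_comp, ← reassoc_of% (h Z k), MonoidalCategory.whiskerLeft_comp,
    ← reassoc_of% (rot_comp_whiskerRight k φ), ← h', Category.assoc]
  congr 1
  rw [Iso.inv_comp_eq, ← Category.assoc, Iso.eq_comp_inv, hφ]

theorem IsTwist.unique {X : C} {l : ∀ Z : C, Z ⊗ X ≅ X ⊗ Z}
    {T T' : X ⟶ X} (h : IsTwist l T) (h' : IsTwist l T') : T = T' := by
  simpa using h.naturality h' (𝟙 X) (by simp)

theorem isIso_of_bijective_comp {X : C} (T : X ⟶ X)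
    (h : ∀ Z : C, Function.Bijective fun m : 𝟙_ C ⟶ Z ⊗ X => m ≫ Z ◁ T) : IsIso T := by
  let := BraidedCategory.exactPairing_swap X Xᘁ
  obtain ⟨m, hm⟩ := (h Xᘁ).2 (η_ Xᘁ X)
  obtain ⟨g, rfl⟩ := exists_comp_whiskerLeft m
  have h1 : g ≫ T = 𝟙 X := by
    refine eq_of_comp_whiskerLeft fun Z k => ?_
    obtain ⟨n, hn⟩ := exists_comp_whiskerRight (rot k)
    simp only [Category.assoc, ← MonoidalCategory.whiskerLeft_comp] at hm
    rw [hn, Category.assoc, Category.assoc, ← whisker_exchange, ← whisker_exchange,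
      ← Category.assoc,
      hm]
    simp
  refine ⟨g, eq_of_comp_whiskerLeft fun Z k => (h Z).1 ?_, h1⟩
  simp [← MonoidalCategory.whiskerLeft_comp, h1]

/-- Rotation and `l` are both bijective on vectors, so composition with `T` is too, and duality
turns this into invertibility. -/
theorem IsTwist.isIso {X : C} {l : ∀ Z : C, Z ⊗ X ≅ X ⊗ Z} {T : X ⟶ X} (h : IsTwist l T) :
    IsIso T := by
  refine isIso_of_bijective_comp T fun Z => ⟨fun m m' hm => ?_, fun m => ?_⟩
  · obtain ⟨k, rfl⟩ := exists_rot_eq m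
    obtain ⟨k', rfl⟩ := exists_rot_eq m'
    simp only [← h Z, cancel_mono] at hm
    rw [hm]
  · exact ⟨rot (m ≫ (l Z).hom), by simp [← h Z]⟩

theorem isTwist_braiding (A : C) : IsTwist (fun Z => β_ Z A) (twist A).hom := by
  intro Z k
  rw [← comp_twist_whiskerRight, rot_eq]
  simp

theorem isTwist_braiding_inv (A : C) : IsTwist (fun Z => (β_ A Z).symm) (twist A).inv := by
  intro Z k
  simp [rot]

end

section
variable {C : Type u} [Category.{v} C] [MonoidalCategory C]

/-- Multiplicativity at `𝟙_ ⊗ 𝟙_` makes this map idempotent up to unitors, and it is invertible. -/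
theorem lam_unit {X : C} (b : HalfBraiding X) : (lam b (𝟙_ C)).hom = (λ_ X).hom ≫ (ρ_ X).inv := by
  have h := lam_naturality b (λ_ (𝟙_ C)).hom
  rw [lam_tensor] at h
  have h1 : (λ_ (𝟙_ C)).hom ▷ X ≫ (lam b (𝟙_ C)).hom =
      (α_ (𝟙_ C) (𝟙_ C) X).hom ≫ 𝟙_ C ◁ (lam b (𝟙_ C)).hom ≫ (α_ (𝟙_ C) X (𝟙_ C)).inv ≫
        (λ_ X).hom ▷ 𝟙_ C := by
    rw [← leftUnitor_tensor_hom, leftUnitor_naturality, leftUnitor_tensor_hom]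
    simp
  rw [h1] at h
  simp only [Category.assoc, cancel_epi, triangle, ← comp_whiskerRight] at h
  rw [Iso.eq_comp_inv, ← MonoidalCategory.whiskerRight_iff, h]

end

/-! ### The curl is the twist of the Drinfeld center. -/

section
variable {C : Type u} [Category.{v} C] [MonoidalCategory C] [BraidedCategory C]
  [RightRigidCategory C] [RibbonCategory C]

open RibbonCategory

/-- The rotated coevaluation is that of the swapped pairing up to `θ_X⁻¹`, which cancels the `θ_X`
in `evTilde`. What remains is a snake identity. -/
theorem rot_coevaluation_evTilde (X : C) :
    rot (η_ X Xᘁ) ▷ Xᘁ ⊗≫ Xᘁ ◁ evTilde X = ⊗𝟙.hom := by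
  have h : rot (η_ X Xᘁ) = η_ X Xᘁ ≫ (β_ Xᘁ X).inv ≫ Xᘁ ◁ (twist X).inv := by
    rw [rot_eq, ← cancel_mono (Xᘁ ◁ (twist X).hom), Category.assoc, Category.assoc,
      ← whisker_exchange, ← BraidedCategory.braiding_inv_naturality_left_assoc,
      reassoc_of% (comp_twist_whiskerRight (η_ X Xᘁ)),
      BraidedCategory.braiding_inv_naturality_right_assoc]
    simp
  let := BraidedCategory.exactPairing_swap X Xᘁ
  have h2 : η_ Xᘁ X = η_ X Xᘁ ≫ (β_ Xᘁ X).inv := rfl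
  have h3 : ε_ Xᘁ X = (β_ X Xᘁ).hom ≫ ε_ X Xᘁ := rfl
  rw [h, evTilde, ← h3, ← reassoc_of% h2]
  calc
    _ = η_ Xᘁ X ▷ Xᘁ ⊗≫ Xᘁ ◁ ((twist X).inv ≫ (twist X).hom) ▷ Xᘁ ⊗≫ Xᘁ ◁ ε_ Xᘁ X := by monoidal
    _ = η_ Xᘁ X ▷ Xᘁ ⊗≫ Xᘁ ◁ ε_ Xᘁ X := by rw [Iso.inv_hom_id]; monoidal
    _ = _ := ExactPairing.evaluation_coevaluation'' _ _

theorem isTwist_curl {X : C} (b : HalfBraiding X) : IsTwist (lam b) (curl b) := by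
  -- Naturality of `λ` at `evTilde X`, together with `lam_unit`, replaces the self-crossing by an
  -- inverse crossing with the dual.
  have h : curl b = 𝟙 _ ⊗≫ X ◁ (η_ X Xᘁ ≫ (lam b Xᘁ).inv) ⊗≫ evTilde X ▷ X ⊗≫ 𝟙 _ := by
    have h1 := lam_naturality b (evTilde X)
    rw [lam_unit, lam_tensor] at h1
    have h2 : (lam b X).hom ▷ Xᘁ ≫ (α_ X X Xᘁ).hom ≫ X ◁ evTilde X =
        (α_ X X Xᘁ).hom ≫ X ◁ (lam b Xᘁ).inv ≫ (α_ X Xᘁ X).inv ≫ evTilde X ▷ X ≫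
          (λ_ X).hom ≫ (ρ_ X).inv := by
      rw [h1]; simp
    rw [curl, reassoc_of% h2]
    monoidal
  have h3 : η_ X Xᘁ ≫ (lam b Xᘁ).inv = rot (η_ X Xᘁ) ≫ Xᘁ ◁ curl b := by
    rw [h]
    generalize η_ X Xᘁ ≫ (lam b Xᘁ).inv = n
    symm
    calc
      _ = 𝟙 _ ⊗≫ (rot (η_ X Xᘁ) ▷ 𝟙_ C ≫ (Xᘁ ⊗ X) ◁ n) ⊗≫ Xᘁ ◁ evTilde X ▷ X ⊗≫ 𝟙 _ := by monoidal
      _ = 𝟙 _ ⊗≫ n ⊗≫ (rot (η_ X Xᘁ) ▷ Xᘁ ⊗≫ Xᘁ ◁ evTilde X) ▷ X ⊗≫ 𝟙 _ := by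
        rw [← whisker_exchange]; monoidal
      _ = _ := by rw [rot_coevaluation_evTilde]; monoidal
  intro Z k
  obtain ⟨m, rfl⟩ := exists_coevaluation_comp k
  rw [rot_comp_whiskerLeft, Category.assoc, Category.assoc, lam_naturality_inv, ← whisker_exchange,
    reassoc_of% h3]

end

/-! ### Twists of tensor products, and their consequences for the curl. -/

section
variable {C : Type u} [Category.{v} C] [MonoidalCategory C] [BraidedCategory C]
  [RightRigidCategory C] [RibbonCategory C]

open RibbonCategory

/-- The tensor product of half-braidings -/
def tensorLam {X Y : C} (a : HalfBraiding X) (b : HalfBraiding Y) (Z : C) :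
    Z ⊗ (X ⊗ Y) ≅ (X ⊗ Y) ⊗ Z :=
  (α_ Z X Y).symm ≪≫ whiskerRightIso (lam a Z) Y ≪≫ α_ X Z Y ≪≫ whiskerLeftIso X (lam b Z) ≪≫
    (α_ X Y Z).symm

/-- Apply the twist property first to `X` passing `Y ⊗ Z`, then to `Y` passing `Z ⊗ X`. Each factor
also crosses the other, which produces the two mutual half-braidings. -/
theorem isTwist_tensorLam {X Y : C} (a : HalfBraiding X) (b : HalfBraiding Y) {T : X ⟶ X}
    {T' : Y ⟶ Y} (h : IsTwist (lam a) T) (h' : IsTwist (lam b) T') :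
    IsTwist (tensorLam a b) ((lam b X).hom ≫ (lam a Y).hom ≫ (T ⊗ₘ T')) := by
  have key : ∀ (Z : C) (k : 𝟙_ C ⟶ (X ⊗ Y) ⊗ Z),
      k ≫ ((lam a Y).inv ≫ (lam b X).inv) ▷ Z ≫ (tensorLam a b Z).inv =
        rot k ≫ Z ◁ (T ⊗ₘ T') := by
    intro Z k
    have h1 := h (Y ⊗ Z) (k ≫ (α_ X Y Z).hom)
    have h2 := h' (Z ⊗ X) (rot (k ≫ (α_ X Y Z).hom) ≫ (Y ⊗ Z) ◁ T ≫ (α_ Y Z X).hom)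
    have h3 : (lam a (Y ⊗ Z)).inv ≫ (α_ Y Z X).hom ≫ (lam b (Z ⊗ X)).inv =
        (α_ X Y Z).inv ≫ ((lam a Y).inv ≫ (lam b X).inv) ▷ Z ≫ (α_ X Y Z).hom ≫
          X ◁ (lam b Z).inv ≫ (α_ X Z Y).inv ≫ (lam a Z).inv ▷ Y := by
      simp [lam_tensor_inv a, lam_naturality_inv, lam_tensor_inv b X Z]
    have h4 : rot (rot (k ≫ (α_ X Y Z).hom) ≫ (Y ⊗ Z) ◁ T ≫ (α_ Y Z X).hom) =
        rot (rot (k ≫ (α_ X Y Z).hom) ≫ (α_ Y Z X).hom) ≫ (Z ◁ T) ▷ Y := by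
      rw [← rot_comp_whiskerLeft]
      simp
    rw [h4, ← reassoc_of% h1] at h2
    simp only [Category.assoc, h3] at h2
    rw [rot_tensor]
    simp only [tensorLam, Iso.trans_inv, Iso.symm_inv, whiskerRightIso_inv, whiskerLeftIso_inv,
      Category.assoc]
    simp only [Iso.hom_inv_id_assoc] at h2
    rw [reassoc_of% h2, MonoidalCategory.tensorHom_def]
    simp
  intro Z k
  have := key Z (k ≫ ((lam b X).hom ≫ (lam a Y).hom) ▷ Z)
  rw [rot_comp_whiskerRight, Category.assoc, Category.assoc, ← comp_whiskerRight_assoc] at this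
  simpa using this

omit [RightRigidCategory C] [RibbonCategory C] in
/-- The braiding, as a half-braiding. -/
def braidingHalf (A : C) : HalfBraiding A :=
  ofLam A (fun Z => β_ Z A) (fun f => by simp) (fun Z W => by simp)

omit [RightRigidCategory C] [RibbonCategory C] in
@[simp] theorem lam_braidingHalf (A Z : C) : lam (braidingHalf A) Z = β_ Z A := by
  simp [braidingHalf]

omit [RightRigidCategory C] [RibbonCategory C] in
/-- The reverse braiding, as a half-braiding. -/
def braidingHalfInv (A : C) : HalfBraiding A :=
  letI := reverseBraiding C
  braidingHalf A

omit [RightRigidCategory C] [RibbonCategory C] in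
@[simp] theorem lam_braidingHalfInv (A Z : C) : lam (braidingHalfInv A) Z = (β_ A Z).symm :=
  letI := reverseBraiding C
  lam_braidingHalf A Z

theorem isTwist_braidingHalf (A : C) : IsTwist (lam (braidingHalf A)) (twist A).hom := by
  convert isTwist_braiding A using 1
  ext Z : 1
  simp

theorem isTwist_braidingHalfInv (A : C) : IsTwist (lam (braidingHalfInv A)) (twist A).inv := by
  convert isTwist_braiding_inv A using 1
  ext Z : 1
  simp

/-- `λ_A` is a morphism of the Drinfeld center from `(A, c) ⊗ (X, λ)` to `(X, λ) ⊗ (A, c)`. In the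
naturality square of the twists, the double braidings and `θ_A` cancel. -/
theorem IsTwist.comm_lam {X : C} (b : HalfBraiding X) {T : X ⟶ X} (h : IsTwist (lam b) T) (A : C) :
    (lam b A).hom ≫ T ▷ A = A ◁ T ≫ (lam b A).hom := by
  have h1 := isTwist_tensorLam (braidingHalf A) b (isTwist_braidingHalf A) h
  have h2 := isTwist_tensorLam b (braidingHalf A) h (isTwist_braidingHalf A)
  have h3 := h1.naturality h2 (lam b A).hom (fun Z => by
    have := lam_braid b (β_ Z A)
    simp [monoidalComp] at this
    simp [tensorLam, reassoc_of% this])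
  simp only [lam_braidingHalf, Category.assoc, cancel_epi] at h3
  rw [MonoidalCategory.tensorHom_def', MonoidalCategory.tensorHom_def', Category.assoc,
    lam_naturality, whisker_exchange, ← Category.assoc, ← Category.assoc, cancel_mono] at h3
  exact h3.symm

theorem curl_dagger {X : C} (b : HalfBraiding X) : curl b ≫ curl (dagger b) = 𝟙 X := by
  refine eq_of_comp_whiskerLeft fun Z k => ?_
  have h1 := isTwist_curl b Z k
  -- Rotating `k'` gives `k` with `λ` undone, so the `λ` inside the inverse of `λ†` restores `k`;
  -- the braidings and twists that are left rotate it.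
  obtain ⟨k', hk'⟩ := exists_rot_eq (rot k ≫ Z ◁ curl b)
  have h2 := isTwist_curl (dagger b) Z k'
  rw [MonoidalCategory.whiskerLeft_comp, ← reassoc_of% hk', ← h2, MonoidalCategory.whiskerLeft_id,
    Category.comp_id]
  have h3 : k' ≫ (β_ Z X).inv = rot k' ≫ (twist Z).hom ▷ X := by
    rw [rot_eq]; simp
  simp only [lam_dagger, Iso.trans_inv, Iso.symm_inv]
  rw [Category.assoc, reassoc_of% h3, hk', ← h1]
  simp only [Category.assoc]
  rw [reassoc_of% (lam_naturality b (twist Z).hom), Iso.inv_hom_id_assoc,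
    ← reassoc_of% (comp_twist_whiskerRight k),
    BraidedCategory.braiding_naturality_left, rot]

end

/-! ### Intertwining properties and curl identities behind `γ₁` and `γ₂`. -/

section
variable {C : Type u} [Category.{v} C] [MonoidalCategory C] [BraidedCategory C]
  [RightRigidCategory C] [RibbonCategory C]

open RibbonCategory

instance isIso_curl {X : C} (b : HalfBraiding X) : IsIso (curl b) := (isTwist_curl b).isIso

/-- Undoing the combined half-braiding undoes `λ¹`, then an ordinary braiding, then `λ²`. The middle
braiding reverses the first rotation up to `θ_X`, which is absorbed by the `θ_Z⁻¹` at the end. -/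
theorem curl_twisted_dagger {X : C} {b₁ b₂ : HalfBraiding X} (h : Comm (dagger b₂) b₁) :
    curl (twisted b₁ (dagger b₂) h) = curl b₁ ≫ curl b₂ := by
  refine (isTwist_curl _).unique fun Z k => ?_
  have h1 := isTwist_curl b₁ Z k
  have h2 := isTwist_curl b₂ Z (k ≫ curl b₁ ▷ Z)
  have h3 : rot k ≫ (β_ X Z).inv = k ≫ (twist X).hom ▷ Z := by
    simp [rot]
  have h4 : (twisted b₁ (dagger b₂) h |> lam <| Z).inv =
      (lam b₁ Z).inv ≫ (β_ X Z).inv ≫ (lam b₂ Z).inv ≫ (twist Z).inv ▷ X := by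
    simp [loop]
  rw [h4, reassoc_of% h1, BraidedCategory.braiding_inv_naturality_right_assoc, reassoc_of% h3,
    ← comp_whiskerRight_assoc, ← twist_naturality, comp_whiskerRight_assoc]
  have h5 := comp_twist_whiskerRight (k ≫ curl b₁ ▷ Z)
  simp only [Category.assoc] at h5 h2
  rw [reassoc_of% h5, reassoc_of% (lam_naturality_inv b₂ (twist Z).hom), hom_inv_whiskerRight,
    Category.comp_id, h2, rot_comp_whiskerRight, MonoidalCategory.whiskerLeft_comp, Category.assoc]

/-- `λ††` differs from `λ` by double braidings. These are the ones that appear when `θ` is made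
natural at `λ_A` and both tensor products are expanded. -/
theorem intertwines_twist {X : C} (b : HalfBraiding X) :
    Intertwines (twist X).hom (dagger (dagger b)) b := by
  intro A
  have h1 : ∀ Y Z : C, (twist (Y ⊗ Z)).hom =
      (β_ Y Z).hom ≫ (β_ Z Y).hom ≫ Y ◁ (twist Z).hom ≫ (twist Y).hom ▷ Z := fun Y Z => by
    rw [twist_tensor, MonoidalCategory.tensorHom_def, Category.assoc, ← whisker_exchange_assoc,
      BraidedCategory.braiding_naturality_left_assoc, BraidedCategory.braiding_naturality_right,
      BraidedCategory.braiding_naturality_right_assoc,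
      BraidedCategory.braiding_naturality_left_assoc]
  have h := twist_naturality (lam b A).hom
  rw [h1, h1, whisker_exchange] at h
  simp only [Category.assoc, lam_naturality] at h
  rw [← cancel_epi ((β_ A X).hom ≫ (β_ X A).hom), ← cancel_mono (X ◁ (twist A).hom)]
  simpa [← whisker_exchange] using h

theorem curl_exchange {X : C} {b₁ b₂ : HalfBraiding X} (h : Comm b₁ b₂) (A : C) :
    (lam b₁ A).hom ≫ (β_ A X).inv ≫ ((twist A).inv ⊗ₘ curl b₁) ≫ (lam b₂ A).hom ≫
      (lam b₁ A).inv = (lam b₂ A).hom ≫ (β_ X A).hom ≫ ((twist A).hom ⊗ₘ curl b₁) := by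
  have h1 := isTwist_tensorLam _ _ (isTwist_braidingHalfInv A) (isTwist_curl b₁)
  have h2 := isTwist_tensorLam _ _ (isTwist_braidingHalf A) (isTwist_curl b₁)
  -- Compatibility turns `c⁻¹` on `A` into `c` in the course of this composite, so the twists on `A`
  -- at its two ends are `θ_A⁻¹` and `θ_A`.
  have h3 := h1.naturality h2 ((lam b₂ A).hom ≫ (lam b₁ A).inv) (fun Z => by
    have e1 := lam_braid b₁ (β_ Z A)
    have e2 := h Z A
    simp [monoidalComp] at e1
    rw [← cancel_mono ((lam b₁ A).hom ▷ Z)]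
    have e3 := e1 =≫ (α_ X A Z).inv
    simp only [Category.assoc, Iso.hom_inv_id, Category.comp_id] at e3
    simp [tensorLam, ← e2, ← e3])
  simpa using h3

theorem lam_dagger_untwisted {X : C} {b₁ b₂ : HalfBraiding X} (h : Comm b₁ b₂) (A : C) :
    (lam (dagger (untwisted b₂ b₁ h)) A).hom =
      (lam (dagger b₂) A).hom ≫ X ◁ (twist A).hom ≫ (lam b₁ A).inv ≫ (β_ A X).hom := by
  simp [loop]

theorem lam_dagger_twisted_dagger {X : C} {b₁ b₂ : HalfBraiding X} (h : Comm (dagger b₂) b₁)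
    (A : C) :
    (lam (dagger (twisted b₁ (dagger b₂) h)) A).hom =
      (β_ X A).inv ≫ (lam b₁ A).inv ≫ (lam (dagger b₂) A).hom ≫ X ◁ (twist A).inv := by
  simp [loop]

/-- Source and target of `γ₂` have the same second half-braiding, so for it the curl only has to
commute with its own half-braiding. -/
theorem lam_untwisted_dagger_untwisted {X : C} {b₁ b₂ : HalfBraiding X} (h : Comm b₁ b₂)
    (h' : Comm (dagger (untwisted b₂ b₁ h)) b₁) (A : C) :
    lam (untwisted b₁ (dagger (untwisted b₂ b₁ h)) h') A = lam (dagger b₂) A := by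
  ext
  have h1 := lam_dagger_untwisted h A
  rw [lam_untwisted, Iso.trans_hom, Iso.symm_hom, loop, Iso.trans_inv, Iso.trans_inv, Iso.symm_inv,
    h1]
  have h2 := lam_naturality b₁ (twist A).inv
  simp only [Iso.hom_inv_id, Category.assoc, Category.id_comp, whiskerRightIso_inv, h2,
    Iso.inv_hom_id_assoc]
  simp [-lam_dagger, ← MonoidalCategory.whiskerLeft_comp]

theorem intertwines_curl {X : C} {b₁ b₂ : HalfBraiding X} (h : Comm b₁ b₂) :
    Intertwines (curl (dagger b₂)) (dagger (twisted b₁ (dagger b₂) (comm_dagger h)))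
      (dagger (untwisted b₂ b₁ h)) := by
  intro A
  have h1 := curl_exchange (comm_dagger h) A
  have h2 := lam_naturality (dagger b₂) (twist A).hom
  rw [lam_dagger_twisted_dagger, lam_dagger_untwisted, ← reassoc_of% h2]
  rw [← cancel_epi ((lam b₁ A).hom ≫ (β_ X A).hom)]
  generalize lam (dagger b₂) A = m at *
  rw [tensorHom_def', MonoidalCategory.tensorHom_def'] at h1
  simp only [Category.assoc, Iso.hom_inv_id_assoc] at h1 ⊢
  rw [← reassoc_of% h1]
  simp only [Iso.inv_hom_id_assoc, Iso.hom_inv_id_assoc, BraidedCategory.braiding_naturality_left,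
    BraidedCategory.braiding_naturality_right_assoc, whisker_exchange]

theorem intertwines_curl_self {X : C} (b : HalfBraiding X) : Intertwines (curl b) b b :=
  (isTwist_curl b).comm_lam

theorem Intertwines.curl_comm {X Y : C} {b : HalfBraiding X} {b' : HalfBraiding Y} {f : X ⟶ Y}
    (h : Intertwines f b b') : curl b ≫ f = f ≫ curl b' :=
  (isTwist_curl b).naturality (isTwist_curl b') f h

end

/-! ### Normal forms for words in `SL₂(ℤ)`. -/

/-- Normal forms `1`, `s`, `s u v`, `s u² v` of the elements of `PSL₂(ℤ) = ⟨s⟩ * ⟨u⟩`, `u = s t`,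
that do not begin with `u`. -/
inductive SNormal
  | one
  | s
  | su (v : SNormal)
  | suu (v : SNormal)

/-- Normal forms `z^e v`, `z^e u v`, `z^e u² v` of the elements of `SL₂(ℤ)`, with `z = s²`. -/
inductive SLNormal
  | nf (e : Bool) (v : SNormal)
  | u (e : Bool) (v : SNormal)
  | uu (e : Bool) (v : SNormal)

namespace SLNormal

/-- Left multiplication by `s`. -/
def mulS : SLNormal → SLNormal
  | nf e .one => nf e .s
  | nf e .s => nf (!e) .one
  | nf e (.su v) => u (!e) v
  | nf e (.suu v) => uu (!e) v
  | u e v => nf e (.su v)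
  | uu e v => nf e (.suu v)

/-- Left multiplication by `u`. -/
def mulU : SLNormal → SLNormal
  | nf e v => u e v
  | u e v => uu e v
  | uu e v => nf (!e) v

/-- Left multiplication by `u⁻¹`. -/
def mulUInv : SLNormal → SLNormal
  | nf e v => uu (!e) v
  | u e v => nf e v
  | uu e v => u e v

/-- Left multiplication by `s⁻¹`. -/
def mulSInv (q : SLNormal) : SLNormal := mulS (mulS (mulS q))

/-- Left multiplication by the letters. -/
def mul : SL2Gen × Bool → SLNormal → SLNormal
  | (.s, true), q => mulS q
  | (.s, false), q => mulSInv q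
  | (.t, true), q => mulSInv (mulU q)
  | (.t, false), q => mulUInv (mulS q)

@[simp] theorem mulS_four (q : SLNormal) : mulS (mulS (mulS (mulS q))) = q := by
  rcases q with ⟨e, _ | _ | v | v⟩ | ⟨e, v⟩ | ⟨e, v⟩ <;> simp [mulS]

@[simp] theorem mulU_mulUInv (q : SLNormal) : mulU (mulUInv q) = q := by
  cases q <;> simp [mulU, mulUInv]

@[simp] theorem mulUInv_mulU (q : SLNormal) : mulUInv (mulU q) = q := by
  cases q <;> simp [mulU, mulUInv]

theorem mulU_three (q : SLNormal) : mulU (mulU (mulU q)) = mulS (mulS q) := by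
  rcases q with ⟨e, _ | _ | v | v⟩ | ⟨e, v⟩ | ⟨e, v⟩ <;> simp [mulS, mulU]

@[simp] theorem mulS_mulSInv (q : SLNormal) : mulS (mulSInv q) = q := mulS_four q

@[simp] theorem mulSInv_mulS (q : SLNormal) : mulSInv (mulS q) = q := mulS_four q

@[simp] theorem mulUInv_mulS_mulS (q : SLNormal) : mulUInv (mulS (mulS q)) = mulU (mulU q) := by
  rw [← mulU_three, mulUInv_mulU]

@[simp] theorem mul_inv_mul (a : SL2Gen × Bool) (q : SLNormal) : mul a (mul (a.1, !a.2) q) = q := by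
  rcases a with ⟨_ | _, _ | _⟩ <;> simp [mul]

end SLNormal

/-! ### Abstract coherence: isomorphisms from words to normal forms. -/

/-- A groupoid with objects `P` and morphisms in a group `A`, with endofunctors `s`, `t` that are
the identity on morphisms and isomorphisms `θ : s⁴ ≅ 1` and `γ : s t s ≅ t⁻¹ s t⁻¹`. -/
structure BraidData (A P : Type*) [Group A] where
  act : SL2Gen × Bool → P → P
  R : A → P → P → Prop
  one : ∀ p, R 1 p p
  mul : ∀ {f g p q r}, R f p q → R g q r → R (g * f) p r
  inv : ∀ {f p q}, R f p q → R f⁻¹ q p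
  map : ∀ a {f p q}, R f p q → R f (act a p) (act a q)
  cancel : ∀ a p, R 1 (act a (act (a.1, !a.2) p)) p
  θ : A
  θ_comm : ∀ f, Commute θ f
  R_θ : ∀ p, R θ (act (.s, true) (act (.s, true) (act (.s, true) (act (.s, true) p)))) p
  γ : P → A
  R_γ : ∀ p, R (γ p) (act (.s, true) (act (.t, true) (act (.s, true) p)))
    (act (.t, false) (act (.s, true) (act (.t, false) p)))
  γ_natural : ∀ {f p q}, R f p q → f * γ p = γ q * f
  -- The inverse of `τ p` turns out to compare `u s² p` with `s² u p`; see `R_τ`.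
  τ : P → A
  γ_act : ∀ p, γ (act (.t, true) (act (.s, true) (act (.t, true) p))) =
    (τ p)⁻¹ * γ (act (.t, true) p)
  τ_act : ∀ p, τ (act (.s, true) (act (.s, true) p)) = (τ p)⁻¹

namespace BraidData

variable {A P : Type*} [Group A] (D : BraidData A P)

open SLNormal

def s (p : P) : P := D.act (.s, true) p

def u (p : P) : P := D.act (.s, true) (D.act (.t, true) p)

/-- In terms of `u = st`, the second relation reads `u³ = s²`, and this is the corresponding
isomorphism. -/
def δ (p : P) : A := D.γ (D.act (.t, true) p)

theorem R_s {f : A} {p q : P} (h : D.R f p q) : D.R f (D.s p) (D.s q) := D.map _ h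

theorem R_u {f : A} {p q : P} (h : D.R f p q) : D.R f (D.u p) (D.u q) := D.map _ (D.map _ h)

theorem R_of_s {f : A} {p q : P} (h : D.R f (D.s p) (D.s q)) : D.R f p q := by
  have := D.mul (D.mul (D.inv (D.cancel (.s, false) p)) (D.map (.s, false) h))
    (D.cancel (.s, false) q)
  simpa using this

theorem δ_natural {f : A} {p q : P} (h : D.R f p q) : f * D.δ p = D.δ q * f :=
  D.γ_natural (D.map _ h)

theorem R_δ (p : P) : D.R (D.δ p) (D.u (D.u (D.u p))) (D.s (D.s p)) := by
  have h := D.R_u (D.R_γ (D.act (.t, true) p))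
  have h1 := D.map (.s, true) (D.cancel (.t, true)
    (D.act (.s, true) (D.act (.t, false) (D.act (.t, true) p))))
  have h2 := D.map (.s, true) (D.map (.s, true) (D.cancel (.t, false) p))
  have := D.mul (D.mul h h1) h2
  rwa [one_mul, one_mul] at this

theorem δ_u (p : P) : D.δ (D.u p) = (D.τ p)⁻¹ * D.δ p := D.γ_act p

/-- Both sides are isomorphic to `u⁴ p`, through `δ p` and through `δ (u p)`. -/
theorem R_τ (p : P) : D.R (D.τ p)⁻¹ (D.u (D.s (D.s p))) (D.s (D.s (D.u p))) := by
  have h := D.mul (D.R_u (D.inv (D.R_δ p))) (D.R_δ (D.u p))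
  rwa [δ_u, mul_inv_cancel_right] at h

theorem τ_s (p : P) : D.τ (D.s (D.s p)) = (D.τ p)⁻¹ := D.τ_act p

/-- The object `v p`. -/
def objS (p : P) : SNormal → P
  | .one => p
  | .s => D.s p
  | .su v => D.s (D.u (objS p v))
  | .suu v => D.s (D.u (D.u (objS p v)))

def z : Bool → P → P
  | false, p => p
  | true, p => D.s (D.s p)

/-- The object `q p`. -/
def obj (p : P) : SLNormal → P
  | nf e v => D.z e (D.objS p v)
  | SLNormal.u e v => D.z e (D.u (D.objS p v))
  | uu e v => D.z e (D.u (D.u (D.objS p v)))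

/-- Prepending `s` changes the object only where four letters `s` meet; there `θ` removes them. -/
def κS : SLNormal → A
  | nf true .s => D.θ
  | nf true (.su _) => D.θ
  | nf true (.suu _) => D.θ
  | _ => 1

theorem R_κS (p : P) (q : SLNormal) : D.R (D.κS q) (D.s (D.obj p q)) (D.obj p (mulS q)) := by
  rcases q with ⟨_ | _, _ | _ | v | v⟩ | ⟨_ | _, v⟩ | ⟨_ | _, v⟩ <;>
    first | exact D.one _ | exact D.R_θ _

theorem κS_four (q : SLNormal) :
    D.κS (mulS (mulS (mulS q))) * D.κS (mulS (mulS q)) * D.κS (mulS q) * D.κS q = D.θ := by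
  rcases q with ⟨_ | _, _ | _ | v | v⟩ | ⟨_ | _, v⟩ | ⟨_ | _, v⟩ <;> simp [κS, mulS]

/-- `u` first moves past the central `z`, at the cost of `τ⁻¹`; if this makes `u³`, then `δ` turns
it into `z`, and `θ` removes a resulting `z²`. -/
def κU (p : P) : SLNormal → A
  | nf false _ => 1
  | SLNormal.u false _ => 1
  | uu false v => D.δ (D.objS p v)
  | nf true v => (D.τ (D.objS p v))⁻¹
  | SLNormal.u true v => (D.τ (D.u (D.objS p v)))⁻¹
  | uu true v => D.θ * (D.δ (D.objS p v) * (D.τ (D.u (D.u (D.objS p v))))⁻¹)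

theorem R_κU (p : P) (q : SLNormal) : D.R (D.κU p q) (D.u (D.obj p q)) (D.obj p (mulU q)) := by
  rcases q with ⟨_ | _, v⟩ | ⟨_ | _, v⟩ | ⟨_ | _, v⟩
  · exact D.one _
  · exact D.R_τ _
  · exact D.one _
  · exact D.R_τ _
  · exact D.R_δ _
  · exact D.mul (D.mul (D.R_τ _) (D.R_s (D.R_s (D.R_δ _)))) (D.R_θ _)

theorem κU_three (p : P) (q : SLNormal) :
    D.κU p (mulU (mulU q)) * D.κU p (mulU q) * D.κU p q =
      D.κS (mulS q) * D.κS q * D.δ (D.obj p q) := by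
  -- Naturality of `δ` along `δ y : u³ y ⟶ s² y`, with `δ (u³ y)` expanded by `δ_u`.
  have hc : ∀ y, D.δ y * (D.τ (D.u (D.u y)))⁻¹ * (D.τ (D.u y))⁻¹ = D.δ (D.s (D.s y)) * D.τ y := by
    intro y
    have h := D.δ_natural (D.R_δ y)
    rw [δ_u, δ_u, δ_u] at h
    rw [← mul_inv_eq_iff_eq_mul, ← mul_left_inj (D.δ y), ← h]
    group
  -- Naturality of `δ` along the comparison of `u s² y` with `s² u y`.
  have hd : ∀ y, D.δ (D.s (D.s (D.u y))) = D.δ (D.s (D.s y)) * D.τ y := fun y => by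
    have := D.δ_natural (D.R_τ y)
    rw [δ_u, τ_s, inv_inv] at this
    rw [← mul_inv_eq_iff_eq_mul, ← this, inv_mul_cancel_left]
  rcases q with ⟨_ | _, v⟩ | ⟨_ | _, v⟩ | ⟨_ | _, v⟩
  · have : D.κS (mulS (nf false v)) * D.κS (nf false v) = 1 := by
      cases v <;> simp [κS, mulS]
    simp [κU, mulU, this, obj, z]
  · have : D.κS (mulS (nf true v)) * D.κS (nf true v) = D.θ := by
      cases v <;> simp [κS, mulS]
    have h := mul_inv_eq_iff_eq_mul.2 (hc (D.objS p v))
    rw [this, obj, z, ← h]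
    simp [κU, mulU, mul_assoc]
  · simp [κU, κS, mulU, mulS, obj, z, δ_u]
  · simp [κU, κS, mulU, mulS, obj, z, hd, ← hc, mul_assoc]
  · simp [κU, κS, mulU, mulS, obj, z, δ_u, mul_assoc]
  · simp [κU, κS, mulU, mulS, obj, z, hd, ← hc, mul_assoc]

/-- `t` is read as `s⁻¹ u`, and inverse letters get inverse isomorphisms, so trivial relations hold
by construction. -/
def κ (p : P) : SL2Gen × Bool → SLNormal → A
  | (.s, true), q => D.κS q
  | (.s, false), q => (D.κS (mulSInv q))⁻¹
  | (.t, true), q => (D.κS (mulSInv (mulU q)))⁻¹ * D.κU p q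
  | (.t, false), q => (D.κU p (mulUInv (mulS q)))⁻¹ * D.κS q

theorem R_κ (p : P) (a : SL2Gen × Bool) (q : SLNormal) :
    D.R (D.κ p a q) (D.act a (D.obj p q)) (D.obj p (SLNormal.mul a q)) := by
  have hs : ∀ q, D.R (D.κS (mulSInv q))⁻¹ (D.obj p q) (D.s (D.obj p (mulSInv q))) := fun q => by
    simpa [mulSInv] using D.inv (D.R_κS p (mulSInv q))
  rcases a with ⟨_ | _, _ | _⟩
  · have := D.mul (D.map (.s, false) (hs q)) (D.cancel (.s, false) _)
    rwa [one_mul] at this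
  · exact D.R_κS p q
  · have h := D.inv (D.R_κU p (mulUInv (mulS q)))
    rw [mulU_mulUInv] at h
    have h2 := D.mul (D.map (.s, false) (D.mul (D.R_κS p q) h)) (D.cancel (.s, false) _)
    have h3 := D.mul (D.inv (D.cancel (.s, false) (D.obj p q))) h2
    have h4 := D.mul (D.map (.t, false) h3) (D.cancel (.t, false) _)
    rwa [one_mul, one_mul, inv_one, mul_one] at h4
  · exact D.R_of_s (D.mul (D.R_κU p q) (hs _))

theorem κ_cancel (p : P) (a : SL2Gen × Bool) (q : SLNormal) :
    D.κ p a (SLNormal.mul (a.1, !a.2) q) * D.κ p (a.1, !a.2) q = 1 := by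
  rcases a with ⟨_ | _, _ | _⟩ <;> simp [SLNormal.mul, κ, mulSInv]

theorem κ_relation (p : P) (q : SLNormal) :
    D.κ p (.s, true) (SLNormal.mul (.t, true) (SLNormal.mul (.s, true) q)) *
        (D.κ p (.t, true) (SLNormal.mul (.s, true) q) * D.κ p (.s, true) q) =
      D.κ p (.t, false) (SLNormal.mul (.s, true) (SLNormal.mul (.t, false) q)) *
        (D.κ p (.s, true) (SLNormal.mul (.t, false) q) * D.κ p (.t, false) q) *
        D.γ (D.obj p q) := by
  -- At `t h` the relation becomes `u³ = s²` at `h`, and naturality of `γ` along `κ` turns its value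
  -- there into `δ`.
  obtain ⟨h, rfl⟩ : ∃ h, q = SLNormal.mul (.t, true) h :=
    ⟨SLNormal.mul (.t, false) q, by simp [SLNormal.mul, mulSInv]⟩
  have h1 := D.γ_natural (D.R_κ p (.t, true) h)
  have h2 := D.κU_three p h
  simp only [κ, SLNormal.mul, mulS_mulSInv, mulUInv_mulU, mulUInv_mulS_mulS] at h1 ⊢
  replace h1 := eq_mul_inv_iff_mul_eq.2 h1.symm
  have h3 := eq_mul_inv_iff_mul_eq.2 h2
  rw [← eq_inv_mul_iff_mul_eq] at h3
  rw [h1, h3, δ]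
  group

/-- The action of a word. -/
def wordAct (p : P) : Word SL2Gen → P
  | [] => p
  | a :: w => D.act a (wordAct p w)

end BraidData

/-- The normal form of a word. -/
def wordNormal : Word SL2Gen → SLNormal
  | [] => .nf false .one
  | a :: w => SLNormal.mul a (wordNormal w)

namespace BraidData

variable {A P : Type*} [Group A] (D : BraidData A P)

/-- The canonical isomorphism from `w p` to `q p`, where `q` is the normal form of the word `w`. -/
def toNormal (p : P) : Word SL2Gen → A
  | [] => 1
  | a :: w => D.κ p a (wordNormal w) * toNormal p w

theorem R_toNormal (p : P) : ∀ w, D.R (D.toNormal p w) (D.wordAct p w) (D.obj p (wordNormal w))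
  | [] => D.one _
  | a :: w => D.mul (D.map a (R_toNormal p w)) (D.R_κ p a _)

/-- A prefix contributes factors on the left that see the rest of the word only through its normal
form, so moves need checking only without a prefix. -/
theorem toNormal_append (p : P) {v v' : Word SL2Gen} {f : A} (h : wordNormal v = wordNormal v')
    (hv : D.toNormal p v = D.toNormal p v' * f) : ∀ x,
      wordNormal (x ++ v) = wordNormal (x ++ v') ∧
        D.toNormal p (x ++ v) = D.toNormal p (x ++ v') * f
  | [] => ⟨h, hv⟩
  | a :: x => by
    obtain ⟨h1, h2⟩ := toNormal_append p h hv x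
    simp [wordNormal, toNormal, h1, h2, mul_assoc]

theorem toNormal_cancel (p : P) (x : Word SL2Gen) (a : SL2Gen × Bool) (y : Word SL2Gen) :
    D.toNormal p (x ++ ([a, (a.1, !a.2)] ++ y)) = D.toNormal p (x ++ ([] ++ y)) := by
  have := (D.toNormal_append p (v := [a, (a.1, !a.2)] ++ y) (v' := [] ++ y) (f := 1)
    (by simp [wordNormal]) (by simp [toNormal, wordNormal, ← mul_assoc, κ_cancel]) x).2
  simpa using this

theorem toNormal_r₁ (p : P) (x y : Word SL2Gen) :
    D.toNormal p (x ++ (slRel.lhs .r₁ ++ y)) = D.toNormal p (x ++ (slRel.rhs .r₁ ++ y)) * D.θ := by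
  refine (D.toNormal_append p ?_ ?_ x).2
  · simp [wordNormal, slRel, SLNormal.mul]
  · simp [toNormal, wordNormal, slRel, SLNormal.mul, κ, ← mul_assoc, κS_four]
    exact D.θ_comm _

theorem toNormal_r₂ (p : P) (x y : Word SL2Gen) :
    D.toNormal p (x ++ (slRel.lhs .r₂ ++ y)) =
      D.toNormal p (x ++ (slRel.rhs .r₂ ++ y)) * D.γ (D.wordAct p y) := by
  refine (D.toNormal_append p ?_ ?_ x).2
  · simp [wordNormal, slRel, SLNormal.mul]
  · have h := D.γ_natural (D.R_toNormal p y)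
    have h1 := D.κ_relation p (wordNormal y)
    simp only [slRel, List.cons_append, List.nil_append, toNormal, wordNormal]
    rw [mul_assoc, mul_assoc, mul_assoc, h]
    simpa only [mul_assoc, mul_left_inj] using congrArg (· * D.toNormal p y) h1

end BraidData

/-! ### The presentation of `SL₂(ℤ)`. -/

/-- A group with elements `s`, `t` that satisfy the relations, as a discrete groupoid. -/
def discreteBraidData {G : Type*} [Group G] (g : SL2Gen → G)
    (h₁ : g .s * (g .s * (g .s * g .s)) = 1)
    (h₂ : g .s * (g .t * g .s) = (g .t)⁻¹ * (g .s * (g .t)⁻¹)) : BraidData Unit G where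
  act a p := cond a.2 (g a.1) (g a.1)⁻¹ * p
  R _ p q := p = q
  one _ := rfl
  mul := Eq.trans
  inv := Eq.symm
  map _ _ _ _ h := by rw [h]
  cancel a p := by rcases a with ⟨_, _ | _⟩ <;> simp
  θ := 1
  θ_comm _ := rfl
  R_θ p := by
    calc
      _ = g .s * (g .s * (g .s * g .s)) * p := by simp [mul_assoc]
      _ = p := by rw [h₁, one_mul]
  γ _ := 1
  R_γ p := by
    simp only [cond_true, cond_false]
    have := congrArg (· * p) h₂
    simpa only [mul_assoc] using this
  γ_natural _ := rfl
  τ _ := 1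
  γ_act _ := rfl
  τ_act _ := rfl

theorem lift_mk_eq_wordAct {G : Type*} [Group G] (g : SL2Gen → G) (h₁) (h₂) (w : Word SL2Gen) :
    FreeGroup.lift g (FreeGroup.mk w) = (discreteBraidData g h₁ h₂).wordAct 1 w := by
  induction w with
  | nil => rfl
  | cons a w ih =>
    rw [BraidData.wordAct, ← ih]
    simp [discreteBraidData]

theorem lift_mk_eq_obj {G : Type*} [Group G] (g : SL2Gen → G) (h₁) (h₂) (w : Word SL2Gen) :
    FreeGroup.lift g (FreeGroup.mk w) = (discreteBraidData g h₁ h₂).obj 1 (wordNormal w) := by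
  rw [lift_mk_eq_wordAct g h₁ h₂]
  exact (discreteBraidData g h₁ h₂).R_toNormal 1 w

theorem coe_slGen_s : (slGen .s).1 = !![0, -1; 1, 0] := rfl

theorem coe_slGen_t : (slGen .t).1 = !![1, 1; 0, 1] := rfl

theorem slGen_r₁ : slGen .s * (slGen .s * (slGen .s * slGen .s)) = 1 := by
  apply Subtype.ext
  simp [coe_slGen_s, Matrix.one_fin_two]

theorem slGen_r₂ : slGen .s * (slGen .t * slGen .s) =
    (slGen .t)⁻¹ * (slGen .s * (slGen .t)⁻¹) := by
  rw [eq_inv_mul_iff_mul_eq, ← mul_inv_eq_iff_eq_mul, inv_inv]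
  apply Subtype.ext
  simp [coe_slGen_s, coe_slGen_t]

/-- The action of `SL₂(ℤ)` on itself. -/
def slData : BraidData Unit (Matrix.SpecialLinearGroup (Fin 2) ℤ) :=
  discreteBraidData slGen slGen_r₁ slGen_r₂

theorem coe_slData_s (p : Matrix.SpecialLinearGroup (Fin 2) ℤ) :
    (slData.s p).1 = !![0, -1; 1, 0] * p.1 := rfl

theorem coe_slData_u (p : Matrix.SpecialLinearGroup (Fin 2) ℤ) :
    (slData.u p).1 = !![0, -1; 1, 1] * p.1 := by
  have : (slData.u p).1 = !![0, -1; 1, 0] * (!![1, 1; 0, 1] * p.1) := rfl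
  rw [this, ← mul_assoc]
  simp

/-- `su` and `su²` act as minus the upper and lower elementary unipotent matrices. A normal form is
thus, up to sign, a nonnegative matrix with positive diagonal, or such a matrix times `s`. -/
theorem objS_slData (v : SNormal) : ∃ ε a b c d : ℤ,
    (ε = 1 ∨ ε = -1) ∧ 1 ≤ a ∧ 1 ≤ d ∧ 0 ≤ b ∧ 0 ≤ c ∧
      (((slData.objS 1 v).1 = ε • !![a, b; c, d] ∧ (v = .one ∧ ε = 1 ∨ 1 ≤ b + c)) ∨
        (slData.objS 1 v).1 = ε • !![b, -a; d, -c]) := by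
  induction v with
  | one => exact ⟨1, 1, 0, 0, 1, by simp [BraidData.objS, Matrix.one_fin_two]⟩
  | s => exact ⟨1, 1, 0, 0, 1, by simp [BraidData.objS, coe_slData_s]⟩
  | su v ih =>
    obtain ⟨ε, a, b, c, d, hε, ha, hd, hb, hc, h⟩ := ih
    refine ⟨-ε, a + c, b + d, c, d, by omega, by omega, by omega, by omega, by omega, ?_⟩
    rcases h with ⟨h, -⟩ | h
    · left
      refine ⟨?_, by omega⟩
      simp [BraidData.objS, coe_slData_s, coe_slData_u, h]
      ring_nf
      simp
    · right
      simp [BraidData.objS, coe_slData_s, coe_slData_u, h]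
      ring_nf
      simp
  | suu v ih =>
    obtain ⟨ε, a, b, c, d, hε, ha, hd, hb, hc, h⟩ := ih
    refine ⟨-ε, a, b, a + c, b + d, by omega, by omega, by omega, by omega, by omega, ?_⟩
    rcases h with ⟨h, -⟩ | h
    · left
      refine ⟨?_, by omega⟩
      simp [BraidData.objS, coe_slData_s, coe_slData_u, h]
      ring_nf
      simp
    · right
      simp [BraidData.objS, coe_slData_s, coe_slData_u, h]
      ring_nf
      simp

theorem coe_slData_z (e : Bool) (p : Matrix.SpecialLinearGroup (Fin 2) ℤ) :
    (slData.z e p).1 = (cond e (-1) 1 : ℤ) • p.1 := by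
  cases e
  · simp [BraidData.z]
  · have : !![0, -1; 1, 0] * !![0, -1; 1, 0] = (-1 : Matrix (Fin 2) (Fin 2) ℤ) := by
      simp [Matrix.one_fin_two]
    rw [BraidData.z, coe_slData_s, coe_slData_s, ← mul_assoc, this]
    simp

/-- A leading `u` or `u²`, or a final `s`, leads to a contradiction of signs or a nonzero
off-diagonal entry; otherwise `b + c = 0` leaves only the trivial form. -/
theorem eq_of_obj_slData_eq_one (q : SLNormal) (hq : slData.obj 1 q = 1) : q = .nf false .one := by
  have hq := congrArg Subtype.val hq
  rcases q with ⟨e, v⟩ | ⟨e, v⟩ | ⟨e, v⟩ <;>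
    obtain ⟨ε, a, b, c, d, hε, ha, hd, hb, hc, ⟨h, hv⟩ | h⟩ := objS_slData v <;>
    simp only [BraidData.obj, coe_slData_u, coe_slData_z, h] at hq <;>
    have h00 := congrFun (congrFun hq 0) 0 <;>
    have h01 := congrFun (congrFun hq 0) 1 <;>
    have h10 := congrFun (congrFun hq 1) 0 <;>
    have h11 := congrFun (congrFun hq 1) 1 <;>
    rcases hε with rfl | rfl <;> cases e <;>
    simp at h00 h01 h10 h11 <;> first | omega | skip
  all_goals
    obtain ⟨rfl, hε⟩ | hv := hv
    · rfl
    · omega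

theorem isPresentation_slGen : IsPresentation slGen slRel := by
  constructor
  · rw [← MonoidHom.range_eq_top, FreeGroup.range_lift_eq_closure, eq_top_iff,
      ← SpecialLinearGroup.SL2Z_generators, Subgroup.closure_le]
    rintro _ (rfl | rfl)
    · exact Subgroup.subset_closure ⟨.s, rfl⟩
    · exact Subgroup.subset_closure ⟨.t, rfl⟩
  · apply le_antisymm
    · intro x hx
      obtain ⟨x, rfl⟩ : ∃ w, FreeGroup.mk w = x := Quot.exists_rep x
      set N := Subgroup.normalClosure
        (Set.range fun r => FreeGroup.mk (slRel.lhs r) * (FreeGroup.mk (slRel.rhs r))⁻¹)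
      -- The presented group satisfies the relations too, so a word with trivial normal form is
      -- already trivial there.
      let g : SL2Gen → FreeGroup SL2Gen ⧸ N := fun i => QuotientGroup.mk (FreeGroup.of i)
      have hr : ∀ r, (QuotientGroup.mk (FreeGroup.mk (slRel.lhs r)) : FreeGroup SL2Gen ⧸ N) =
          QuotientGroup.mk (FreeGroup.mk (slRel.rhs r)) := fun r => by
        rw [QuotientGroup.eq_iff_div_mem, div_eq_mul_inv]
        exact Subgroup.subset_normalClosure ⟨r, rfl⟩
      have h₁ : g .s * (g .s * (g .s * g .s)) = 1 := hr .r₁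
      have h₂ : g .s * (g .t * g .s) = (g .t)⁻¹ * (g .s * (g .t)⁻¹) := hr .r₂
      have hg : FreeGroup.lift g = QuotientGroup.mk' N := by
        ext i; simp [g]
      rw [MonoidHom.mem_ker,
        lift_mk_eq_obj slGen slGen_r₁ slGen_r₂] at hx
      rw [← QuotientGroup.ker_mk' N, MonoidHom.mem_ker, ← hg, lift_mk_eq_obj g h₁ h₂,
        eq_of_obj_slData_eq_one _ hx]
      rfl
    · refine Subgroup.normalClosure_le_normal ?_
      rintro _ ⟨_ | _, rfl⟩
      all_goals
        rw [SetLike.mem_coe, MonoidHom.mem_ker, map_mul, map_inv, mul_inv_eq_one]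
      · simpa [slRel] using slGen_r₁
      · simpa [slRel] using slGen_r₂

/-! ### Transfer of coherence to the elliptic Drinfeld center. -/

section
variable {C : Type u} [Category.{v} C] [MonoidalCategory C]

theorem intertwines_id_of_eq {X : C} {b b' : HalfBraiding X} (h : ∀ A, lam b A = lam b' A) :
    Intertwines (𝟙 X) b b' := fun A => by simp [h]

theorem Intertwines.iso_inv {X Y : C} {f : X ≅ Y} {b : HalfBraiding X} {b' : HalfBraiding Y}
    (h : Intertwines f.hom b b') : Intertwines f.inv b' b := fun A => by
  rw [← cancel_mono (f.hom ▷ A), Category.assoc, Category.assoc, h A]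
  simp

variable [BraidedCategory C]

/-- Pairs of half-braidings on `X` that make `X` an object of the elliptic Drinfeld center. -/
structure HalfPair (X : C) where
  b₁ : HalfBraiding X
  b₂ : HalfBraiding X
  comm : Comm b₁ b₂

/-- The object `(X, λ¹, λ²)`. -/
def HalfPair.toZEl {X : C} (p : HalfPair X) : ZEl C := ⟨X, p.b₁, p.b₂, p.comm⟩

/-- The pair of half-braidings of an object. -/
def ZEl.pair (X : ZEl C) : HalfPair X.obj := ⟨X.hb₁, X.hb₂, X.comm⟩

/-- `f` intertwines both half-braidings. -/
def HalfPair.Rel {X Y : C} (f : X ⟶ Y) (p : HalfPair X) (q : HalfPair Y) : Prop :=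
  Intertwines f p.b₁ q.b₁ ∧ Intertwines f p.b₂ q.b₂

/-- The morphism of `𝒵ᵉˡ(C)` with underlying morphism `f`. -/
def HalfPair.Rel.toHom {X Y : C} {f : X ⟶ Y} {p : HalfPair X} {q : HalfPair Y} (h : p.Rel f q) :
    p.toZEl ⟶ q.toZEl := ⟨f, h.1, h.2⟩

theorem HalfPair.rel_f {X Y : ZEl C} (F : X ⟶ Y) : HalfPair.Rel F.f X.pair Y.pair :=
  ⟨F.comm₁, F.comm₂⟩

variable [RightRigidCategory C] [RibbonCategory C]
open RibbonCategory

/-- The pair of half-braidings of `U_a (X, λ¹, λ²)`. -/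
def HalfPair.act {X : C} : SL2Gen × Bool → HalfPair X → HalfPair X
  | (.s, true), p => ⟨dagger p.b₂, p.b₁, comm_dagger p.comm⟩
  | (.s, false), p => ⟨p.b₂, daggerInv p.b₁, comm_daggerInv p.comm⟩
  | (.t, true), p => ⟨p.b₁, twisted p.b₂ p.b₁ p.comm, comm_twisted p.comm⟩
  | (.t, false), p => ⟨p.b₁, untwisted p.b₂ p.b₁ p.comm, comm_untwisted p.comm⟩

theorem HalfPair.Rel.act {X Y : C} (a : SL2Gen × Bool) {f : X ⟶ Y} {p : HalfPair X}
    {q : HalfPair Y} (h : p.Rel f q) : (p.act a).Rel f (q.act a) := by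
  have h' := HalfPair.rel_f ((letterFunctor (slAct C) a).map h.toHom)
  rcases a with ⟨_ | _, _ | _⟩ <;> exact h'

/-- The curl of a half-braiding, as an isomorphism. -/
noncomputable def curlIso {X : C} (b : HalfBraiding X) : Aut X := asIso (curl b)

theorem curlIso_dagger {X : C} (b : HalfBraiding X) : curlIso (dagger b) = (curlIso b)⁻¹ := by
  refine eq_inv_of_mul_eq_one_left ?_
  ext
  exact curl_dagger b

/-- The automorphisms of `X`, as a groupoid on the pairs of half-braidings. -/
noncomputable def autBraidData (X : C) : BraidData (Aut X) (HalfPair X) where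
  act := HalfPair.act
  R f p q := p.Rel f.hom q
  one _ := ⟨intertwines_id _, intertwines_id _⟩
  mul h h' := ⟨h.1.comp h'.1, h.2.comp h'.2⟩
  inv h := ⟨h.1.iso_inv, h.2.iso_inv⟩
  map a _ _ _ h := h.act a
  cancel a p := by
    rcases a with ⟨_ | _, _ | _⟩ <;>
      exact ⟨intertwines_id_of_eq fun A => by ext; simp [HalfPair.act],
        intertwines_id_of_eq fun A => by ext; simp [HalfPair.act]⟩
  θ := twist X
  θ_comm f := by
    ext
    exact twist_naturality f.hom
  R_θ p := ⟨intertwines_twist _, intertwines_twist _⟩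
  γ p := curlIso (dagger p.b₂)
  R_γ p := ⟨intertwines_curl p.comm, fun A => (intertwines_curl_self (dagger p.b₂) A).trans
    (congrArg (fun m => A ◁ curl (dagger p.b₂) ≫ m.hom)
      (lam_untwisted_dagger_untwisted p.comm (comm_dagger (comm_untwisted p.comm)) A).symm)⟩
  γ_natural h := by
    ext
    exact h.2.dagger.curl_comm
  τ p := curlIso p.b₁
  -- Multiplication in `Aut X` is composition in reverse order, which gives the order of the two
  -- curls.
  γ_act p := by
    rw [curlIso_dagger, curlIso_dagger, ← mul_inv_rev]
    congr 1
    ext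
    exact curl_twisted_dagger (comm_dagger (comm_twisted p.comm))
  τ_act p := curlIso_dagger _


/-- The isomorphism of `𝒵ᵉˡ(C)` with underlying isomorphism `f`. -/
def isoMk {X Y : ZEl C} (f : X.obj ≅ Y.obj) (h : HalfPair.Rel f.hom X.pair Y.pair) : X ≅ Y where
  hom := ⟨f.hom, h.1, h.2⟩
  inv := ⟨f.inv, h.1.iso_inv, h.2.iso_inv⟩
  hom_inv_id := by ext; simp
  inv_hom_id := by ext; simp

variable (C) in
/-- The natural isomorphisms `γ₁` and `γ₂`. -/
noncomputable def slIso : ∀ r : SL2Rel,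
    wordFunctor (slAct C) (slRel.lhs r) ≅ wordFunctor (slAct C) (slRel.rhs r)
  | .r₁ => NatIso.ofComponents (fun X => isoMk (Y := X) (twist X.obj)
        ((autBraidData X.obj).R_θ X.pair))
      (fun F => by ext; exact twist_naturality F.f)
  | .r₂ => NatIso.ofComponents (fun X => isoMk (curlIso (dagger X.hb₂) : X.obj ≅ X.obj)
        ((autBraidData X.obj).R_γ X.pair))
      (fun F => by ext; exact F.comm₂.dagger.curl_comm.symm)

/-- `U_a X` and `X` have the same underlying object. -/
def letterObjIso (X : ZEl C) :
    ∀ a : SL2Gen × Bool, ((letterFunctor (slAct C) a).obj X).obj ≅ X.obj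
  | (.s, true) | (.s, false) | (.t, true) | (.t, false) => Iso.refl X.obj

/-- `U_w X` and `X` have the same underlying object. -/
def wordObjIso (X : ZEl C) : ∀ w : Word SL2Gen, ((wordFunctor (slAct C) w).obj X).obj ≅ X.obj
  | [] => Iso.refl X.obj
  | a :: w => letterObjIso ((wordFunctor (slAct C) w).obj X) a ≪≫ wordObjIso X w

theorem letterObjIso_naturality {X Y : ZEl C} (F : X ⟶ Y) (a : SL2Gen × Bool) :
    ((letterFunctor (slAct C) a).map F).f ≫ (letterObjIso Y a).hom =
      (letterObjIso X a).hom ≫ F.f := by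
  rcases a with ⟨_ | _, _ | _⟩ <;> exact (Category.comp_id _).trans (Category.id_comp _).symm

theorem wordObjIso_naturality {X Y : ZEl C} (F : X ⟶ Y) (w : Word SL2Gen) :
    ((wordFunctor (slAct C) w).map F).f ≫ (wordObjIso Y w).hom = (wordObjIso X w).hom ≫ F.f := by
  induction w with
  | nil => exact (Category.comp_id _).trans (Category.id_comp _).symm
  | cons a w ih =>
    have := (reassoc_of% letterObjIso_naturality ((wordFunctor (slAct C) w).map F) a)
      (wordObjIso Y w).hom
    rw [ih] at this
    exact this.trans (Category.assoc _ _ _).symm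

theorem letterObjIso_rel (X : ZEl C) (a : SL2Gen × Bool) :
    HalfPair.Rel (letterObjIso X a).hom ((letterFunctor (slAct C) a).obj X).pair
      (X.pair.act a) := by
  rcases a with ⟨_ | _, _ | _⟩ <;> exact ⟨intertwines_id _, intertwines_id _⟩

theorem wordObjIso_rel (X : ZEl C) (w : Word SL2Gen) :
    HalfPair.Rel (wordObjIso X w).hom ((wordFunctor (slAct C) w).obj X).pair
      ((autBraidData X.obj).wordAct X.pair w) := by
  induction w with
  | nil => exact ⟨intertwines_id _, intertwines_id _⟩
  | cons a w ih =>
    have h1 := letterObjIso_rel ((wordFunctor (slAct C) w).obj X) a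
    have h2 := ih.act a
    exact ⟨h1.1.comp h2.1, h1.2.comp h2.2⟩

theorem appendIso_wordObjIso (X : ZEl C) (x y : Word SL2Gen) :
    ((appendIso (slAct C) x y).hom.app X).f ≫
        (wordObjIso ((wordFunctor (slAct C) y).obj X) x).hom ≫ (wordObjIso X y).hom =
      (wordObjIso X (x ++ y)).hom := by
  induction x with
  | nil => exact (Category.id_comp _).trans (Category.id_comp _)
  | cons a x ih =>
    have := (reassoc_of% letterObjIso_naturality ((appendIso (slAct C) x y).hom.app X) a)
      ((wordObjIso ((wordFunctor (slAct C) y).obj X) x).hom ≫ (wordObjIso X y).hom)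
    rw [ih] at this
    change (((letterFunctor (slAct C) a).map ((appendIso (slAct C) x y).hom.app X)).f ≫ 𝟙 _) ≫
      ((letterObjIso ((wordFunctor (slAct C) x).obj ((wordFunctor (slAct C) y).obj X)) a).hom ≫
        (wordObjIso ((wordFunctor (slAct C) y).obj X) x).hom) ≫ (wordObjIso X y).hom =
      (letterObjIso ((wordFunctor (slAct C) (x ++ y)).obj X) a).hom ≫ (wordObjIso X (x ++ y)).hom
    rw [Category.comp_id, Category.assoc]
    exact this

theorem appendIso_inv_wordObjIso (X : ZEl C) (x y : Word SL2Gen) :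
    ((appendIso (slAct C) x y).inv.app X).f ≫ (wordObjIso X (x ++ y)).hom =
      (wordObjIso ((wordFunctor (slAct C) y).obj X) x).hom ≫ (wordObjIso X y).hom := by
  rw [← appendIso_wordObjIso, ← Category.assoc, ← ZEl.comp_f, Iso.inv_hom_id_app]
  simp

/-- All `U_w` are the identity on underlying morphisms, so once underlying objects are identified
with that of `X`, whiskering leaves the endomorphism `f` unchanged. -/
theorem whiskerIso_wordObjIso (X : ZEl C) (x y : Word SL2Gen) {v v' : Word SL2Gen}
    (e : wordFunctor (slAct C) v ≅ wordFunctor (slAct C) v') (f : X.obj ⟶ X.obj)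
    (h : (e.hom.app ((wordFunctor (slAct C) y).obj X)).f ≫
        (wordObjIso ((wordFunctor (slAct C) y).obj X) v').hom ≫ (wordObjIso X y).hom =
      (wordObjIso ((wordFunctor (slAct C) y).obj X) v).hom ≫ (wordObjIso X y).hom ≫ f) :
    ((whiskerIso (slAct C) x y e).hom.app X).f ≫ (wordObjIso X (x ++ (v' ++ y))).hom =
      (wordObjIso X (x ++ (v ++ y))).hom ≫ f := by
  let e' := appendIso (slAct C) v y ≪≫ Functor.isoWhiskerLeft (wordFunctor (slAct C) y) e ≪≫
    (appendIso (slAct C) v' y).symm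
  have h' := wordObjIso_naturality (e'.hom.app X) x
  have h'' : (e'.hom.app X).f ≫ (wordObjIso X (v' ++ y)).hom =
      (wordObjIso X (v ++ y)).hom ≫ f := by
    rw [← appendIso_wordObjIso X v y, Category.assoc, Category.assoc, ← h,
      ← appendIso_inv_wordObjIso]
    simp [e']
  rw [← appendIso_wordObjIso X x (v ++ y), Category.assoc, Category.assoc, ← h'', ← reassoc_of% h',
    ← appendIso_inv_wordObjIso]
  simp [whiskerIso, e']

/-- The canonical isomorphism from `U_w X` to the value at `X` of the normal form of `w`. -/
noncomputable def toNormalIso (X : ZEl C) (w : Word SL2Gen) :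
    ((wordFunctor (slAct C) w).obj X).obj ≅ X.obj :=
  wordObjIso X w ≪≫ Iso.mk ((autBraidData X.obj).toNormal X.pair w).hom _
    (Iso.hom_inv_id _) (Iso.inv_hom_id _)

theorem toNormalIso_hom_of_eq_mul (X : ZEl C) {w w' : Word SL2Gen} {f : Aut X.obj}
    {g : ((wordFunctor (slAct C) w).obj X).obj ⟶ ((wordFunctor (slAct C) w').obj X).obj}
    (h : (autBraidData X.obj).toNormal X.pair w = (autBraidData X.obj).toNormal X.pair w' * f)
    (hg : g ≫ (wordObjIso X w').hom = (wordObjIso X w).hom ≫ f.hom) :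
    g ≫ (toNormalIso X w').hom = (toNormalIso X w).hom := by
  have : ((autBraidData X.obj).toNormal X.pair w).hom =
      f.hom ≫ ((autBraidData X.obj).toNormal X.pair w').hom := by rw [h]; rfl
  simp only [toNormalIso, Iso.trans_hom, this, reassoc_of% hg]

theorem Move.iso_toNormal (X : ZEl C) {w w' : Word SL2Gen} (m : Move slRel w w') :
    ((m.iso (slAct C) (slIso C)).hom.app X).f ≫ (toNormalIso X w').hom =
      (toNormalIso X w).hom := by
  cases m with
  | rel x r y =>
    cases r with
    | r₁ =>
      refine toNormalIso_hom_of_eq_mul X (BraidData.toNormal_r₁ _ _ _ _)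
        (whiskerIso_wordObjIso X x y _ _ ?_)
      -- The move is applied at `U_y X`; naturality carries its twist to that of `X`.
      have h := twist_naturality (wordObjIso X y).hom
      change (twist _).hom ≫ 𝟙 _ ≫ _ = (𝟙 _ ≫ 𝟙 _ ≫ 𝟙 _ ≫ 𝟙 _ ≫ 𝟙 _) ≫
        (wordObjIso X y).hom ≫ (twist X.obj).hom
      simp only [Category.id_comp, h]
    | r₂ =>
      refine toNormalIso_hom_of_eq_mul X (BraidData.toNormal_r₂ _ _ _ _)
        (whiskerIso_wordObjIso X x y _ _ ?_)
      have h := (wordObjIso_rel X y).2.dagger.curl_comm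
      change curl (dagger _) ≫ (𝟙 _ ≫ 𝟙 _ ≫ 𝟙 _ ≫ 𝟙 _) ≫ _ =
        (𝟙 _ ≫ 𝟙 _ ≫ 𝟙 _ ≫ 𝟙 _) ≫ (wordObjIso X y).hom ≫ curl _
      simp only [Category.id_comp]
      exact h
  | cancel x a y =>
    have h := ((autBraidData X.obj).toNormal_cancel X.pair x a y).trans (mul_one _).symm
    refine toNormalIso_hom_of_eq_mul X h (whiskerIso_wordObjIso X x y
      (v := [a, (a.1, !a.2)]) (v' := []) (cancelIso (slAct C) a) (𝟙 X.obj) ?_)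
    rcases a with ⟨_ | _, _ | _⟩
    all_goals
      change 𝟙 _ ≫ 𝟙 _ ≫ (wordObjIso X y).hom = (𝟙 _ ≫ 𝟙 _ ≫ 𝟙 _) ≫ (wordObjIso X y).hom ≫ 𝟙 _
      simp only [Category.id_comp, Category.comp_id]

omit [RightRigidCategory C] [RibbonCategory C] in
theorem inv_app_comp_of_hom_app_comp {F G : ZEl C ⥤ ZEl C} (e : F ≅ G) (X : ZEl C) {Z : C}
    {f : (F.obj X).obj ⟶ Z} {g : (G.obj X).obj ⟶ Z} (h : (e.hom.app X).f ≫ g = f) :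
    (e.inv.app X).f ≫ f = g := by
  rw [← h, ← Category.assoc, ← ZEl.comp_f, Iso.inv_hom_id_app, ZEl.id_f, Category.id_comp]

theorem Path.iso_toNormal (X : ZEl C) {w w' : Word SL2Gen} (p : Path slRel w w') :
    ((p.iso (slAct C) (slIso C)).hom.app X).f ≫
        (toNormalIso X w').hom =
      (toNormalIso X w).hom := by
  induction p with
  | nil w => exact Category.id_comp _
  | fwd m p ih =>
    rw [Path.iso, Iso.trans_hom, NatTrans.comp_app, ZEl.comp_f, Category.assoc, ih,
      m.iso_toNormal]
  | bwd m p ih =>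
    rw [Path.iso, Iso.trans_hom, NatTrans.comp_app, ZEl.comp_f, Category.assoc, ih]
    exact inv_app_comp_of_hom_app_comp _ X (m.iso_toNormal X)

/-- Both sides, followed by the same isomorphism to the normal form of `w'`, give the isomorphism
from `w` to its normal form. -/
theorem Path.iso_eq {w w' : Word SL2Gen} (p q : Path slRel w w') :
    p.iso (slAct C) (slIso C) = q.iso (slAct C) (slIso C) := by
  ext X
  rw [← cancel_mono (toNormalIso X w').hom,
    p.iso_toNormal, q.iso_toNormal]

end

end EllipticCenter

open EllipticCenter
theorem mainTheorem11 (k : Type*) [Field k] [IsAlgClosed k] [CharZero k]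
    (C : Type u) [Category.{v} C] [Abelian C] [Linear k C]
    [MonoidalCategory C] [MonoidalPreadditive C] [MonoidalLinear k C] [RigidCategory C]
    [BraidedCategory C] [RibbonCategory C] [IsPremodular k C] :
    ∃ γ : ∀ r : SL2Rel,
        wordFunctor (slAct C) (slRel.lhs r) ≅ wordFunctor (slAct C) (slRel.rhs r),
      (∀ X : ZEl C, ((γ .r₁).hom.app X).f = (RibbonCategory.twist X.obj).hom) ∧
      (∀ X : ZEl C, ((γ .r₂).hom.app X).f = curl (dagger X.hb₂)) ∧
      IsGroupAction slGen slRel (slAct C) γ :=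
  ⟨slIso C, fun _ => rfl, fun _ => rfl, isPresentation_slGen, fun _ _ p q => p.iso_eq q⟩
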